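/- **Theorem 5.3.** *Setting.* Let $\mathsf M$ be a wide-sense stationary random $L^2$ signed measure on $\mathbb R^d$: a family of real square-integrable random variables $I_{\mathsf M}(f)=\int f\,d\mathsf M$, indexed by the bounded measurable compactly supported $f:\mathbb R^d\to\mathbb R$, a.s. linear and $\sigma$-additive in $f$, with $\mathrm{Var}(I_{\mathsf M}(f(\cdot-x)))=\mathrm{Var}(I_{\mathsf M}(f))$ for all $x$; $I_{\mathsf M}$ is extended to complex $f$ by complex linearity, and $\mathrm{Var}(X)=\mathbf E|X-\mathbf EX|^2$. Write $\hat f(u)=\int e^{-i\langle u,t\rangle}f(t)\,dt$. Let $\mathsf S$ be the spectral measure of $\mathsf M$, that is, the even non-negative locally finite measure on $\mathbb R^d$ with $\mathrm{Var}(I_{\mathsf M}(f))=\int|\hat f|^2\,d\mathsf S$ for all such $f:\mathbb R^d\to\mathbb R$, and let $\mathsf s$ be the density of its absolutely continuous part with respect to Lebesgue measure. Put $L^2(\mathsf s^{-1})=\{\psi:\int|\psi|^2\mathsf s^{-1}<\infty\}$, with the conventions $1/0=\infty$ and $0\cdot\infty=0$. Let $A\subset\mathbb R^d$ be a convex body (a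 compact convex set with non-empty interior). Let $\mathcal C_c^\infty(A^c)$ be the space of smooth functions $h:\mathbb R^d\to\mathbb C$ whose compact support is contained in $A^c$, and let $\mathcal E(A)$ be the class of restrictions $\psi$ to $\mathbb R^d$ of entire functions of exponential type on $\mathbb C^d$ that have at most polynomial growth on $\mathbb R^d$ and spectrum in $A$, i.e. whose Fourier transform $\hat\psi$, as a tempered distribution ($\langle\varphi,\hat\psi\rangle=\int\hat\varphi\,\psi$), is supported in $A$. For $\gamma:\mathbb R^d\to\mathbb C$ bounded, measurable and compactly supported, $\mathsf M$ is called linearly $\gamma$-rigid on $A$ if $$\inf_{h\in\mathcal C_c^\infty(A^c)}\mathrm{Var}\Big(\int_A\gamma\,d\mathsf M-\int h\,d\mathsf M\Big)=0 .$$ *Conclusion.* 1. For every $\psi\in\mathcal E(A)\cap L^2(\mathsf s^{-1})$ the distribution $\hat\psi$ is a function in $L^2(\mathbb R^d)$ (so that the integral in 2 makes sense). 2. For every bounded measurable compactly supported $\gamma:\mathbb R^d\to\mathbb C$, $\mathsf M$ is linearly $\gamma$-rigid on $A$ if and only if $\int_A\bar\gamma\,\hat\psi\,dt=0$ for every $\psi\in\mathcal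 E(A)\cap L^2(\mathsf s^{-1})$. 3. The orthogonal complement $H_A^\perp=\{\varphi\in L^2(\mathsf S):\int\bar\varphi\,\hat h\,d\mathsf S=0\text{ for all }h\in\mathcal C_c^\infty(A^c)\}$ equals $\{\bar\psi\,\mathsf s^{-1}:\psi\in\mathcal E(A)\cap L^2(\mathsf s^{-1})\}$, where $\bar\psi\,\mathsf s^{-1}$ is understood as an element of $L^2(\mathsf S)$ that vanishes on the singular part of $\mathsf S$. -/

import Mathlib

open MeasureTheory ProbabilityTheory
open scoped ComplexConjugate

noncomputable section

/-- `f` is measurable, bounded and compactly supported. -/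
def IsBddCompact {d : ℕ} {F : Type*} [NormedAddCommGroup F] [MeasurableSpace F]
    (f : EuclideanSpace ℝ (Fin d) → F) : Prop :=
  Measurable f ∧ (∃ C : ℝ, ∀ x, ‖f x‖ ≤ C) ∧ HasCompactSupport f

/-- A wide-sense stationary square-integrable random signed measure on `ℝ^d`: a family of real
square-integrable random variables `M.integral f` (read: `∫ f dM`), indexed by bounded measurable
compactly supported `f`, almost surely linear and countably additive, with
translation-invariant variance. -/
structure StatRandomMeasure {Ω : Type*} [MeasurableSpace Ω] (P : Measure Ω) (d : ℕ) where
  /-- The linear statistic `∫ f dM`; its values on functions `f` that are not bounded, measurable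
  and compactly supported are irrelevant. -/
  integral : (EuclideanSpace ℝ (Fin d) → ℝ) → Ω → ℝ
  memLp : ∀ f, IsBddCompact f → MemLp (integral f) 2 P
  linear : ∀ (a : ℝ) (f g : EuclideanSpace ℝ (Fin d) → ℝ), IsBddCompact f → IsBddCompact g →
    ∀ᵐ ω ∂P, integral (fun x => a * f x + g x) ω = a * integral f ω + integral g ω
  sigma_additive : ∀ (f : EuclideanSpace ℝ (Fin d) → ℝ) (B : ℕ → Set (EuclideanSpace ℝ (Fin d))),
    IsBddCompact f → (∀ n, MeasurableSet (B n)) → Pairwise (fun m n => Disjoint (B m) (B n)) →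
    ∀ᵐ ω ∂P, Filter.Tendsto (fun n => ∑ i ∈ Finset.range n, integral ((B i).indicator f) ω)
      Filter.atTop (nhds (integral ((⋃ n, B n).indicator f) ω))
  stationary : ∀ (x : EuclideanSpace ℝ (Fin d)) (f : EuclideanSpace ℝ (Fin d) → ℝ),
    IsBddCompact f → Var[integral (fun y => f (y - x)); P] = Var[integral f; P]

/-- The Fourier transform `f̂(u) = ∫ e^{-i⟨u,t⟩} f(t) dt` of an integrable function. -/
def fourierHat {d : ℕ} (f : EuclideanSpace ℝ (Fin d) → ℂ) (u : EuclideanSpace ℝ (Fin d)) : ℂ :=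
  ∫ t, Complex.exp (-(Complex.I * ((inner ℝ u t : ℝ) : ℂ))) * f t

/-- `S` is the spectral measure of `M`: the even (locally finite, nonnegative) measure such that
`Var(∫ f dM) = ∫ |f̂|² dS` for every bounded measurable compactly supported real `f`. -/
structure IsSpectralMeasure {Ω : Type*} [MeasurableSpace Ω] {P : Measure Ω} {d : ℕ}
    (M : StatRandomMeasure P d) (S : Measure (EuclideanSpace ℝ (Fin d))) : Prop where
  locallyFinite : IsLocallyFiniteMeasure S
  even : S.map (fun u => -u) = S
  variance_eq : ∀ f : EuclideanSpace ℝ (Fin d) → ℝ, IsBddCompact f →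
    ∫⁻ u, ‖fourierHat (fun t => (f t : ℂ)) u‖ₑ ^ 2 ∂S = ENNReal.ofReal (Var[M.integral f; P])

/-- The spectral density: the density of the absolutely continuous part of `S`. -/
def spectralDensity {d : ℕ} (S : Measure (EuclideanSpace ℝ (Fin d))) :
    EuclideanSpace ℝ (Fin d) → ENNReal :=
  S.rnDeriv volume

/-- The linear statistic `∫ f dM` of a complex-valued function `f`. -/
def StatRandomMeasure.cintegral {Ω : Type*} [MeasurableSpace Ω] {P : Measure Ω} {d : ℕ}
    (M : StatRandomMeasure P d) (f : EuclideanSpace ℝ (Fin d) → ℂ) (ω : Ω) : ℂ :=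
  (M.integral (fun x => (f x).re) ω : ℂ) + Complex.I * (M.integral (fun x => (f x).im) ω : ℂ)

/-- The variance `E|X - E X|²` of a complex random variable. -/
def complexVariance {Ω : Type*} [MeasurableSpace Ω] (P : Measure Ω) (X : Ω → ℂ) : ℝ :=
  ∫ ω, ‖X ω - ∫ ω', X ω' ∂P‖ ^ 2 ∂P

/-- The space `C_c^∞(U)` of smooth complex functions with compact support contained in `U`. -/
def testFunctions {d : ℕ} (U : Set (EuclideanSpace ℝ (Fin d))) :
    Set (EuclideanSpace ℝ (Fin d) → ℂ) :=
  {h | ContDiff ℝ ((⊤ : ℕ∞) : WithTop ℕ∞) h ∧ HasCompactSupport h ∧ tsupport h ⊆ U}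

/-- `M` is linearly `γ`-rigid on `A`:
the infimum of `Var(∫_A γ dM - ∫ h dM)` over `h ∈ C_c^∞(Aᶜ)` is zero. -/
def LinearlyRigid {Ω : Type*} [MeasurableSpace Ω] {P : Measure Ω} {d : ℕ}
    (M : StatRandomMeasure P d) (γ : EuclideanSpace ℝ (Fin d) → ℂ)
    (A : Set (EuclideanSpace ℝ (Fin d))) : Prop :=
  ⨅ h : testFunctions Aᶜ,
    complexVariance P (fun ω => M.cintegral (A.indicator γ) ω - M.cintegral h.1 ω) = 0

/-- The inclusion of `ℝ^d` in `ℂ^d`. -/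
def toComplexSpace {d : ℕ} (u : EuclideanSpace ℝ (Fin d)) : EuclideanSpace ℂ (Fin d) :=
  WithLp.toLp 2 (fun i => (u i : ℂ))

/-- `ψ` is the restriction to `ℝ^d` of an entire function on `ℂ^d` of exponential type. -/
def IsEntireExpType {d : ℕ} (ψ : EuclideanSpace ℝ (Fin d) → ℂ) : Prop :=
  ∃ F : EuclideanSpace ℂ (Fin d) → ℂ, Differentiable ℂ F ∧
    (∃ C R : ℝ, ∀ z, ‖F z‖ ≤ C * Real.exp (R * ‖z‖)) ∧
    ∀ u, ψ u = F (toComplexSpace u)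

/-- The class `E(A)`: entire functions of exponential type, of polynomial growth on `ℝ^d` (so that
they are tempered distributions), whose spectrum is contained in the closed set `A`, that is,
whose distributional Fourier transform `φ ↦ ∫ φ̂ ψ` vanishes on all test functions `φ` supported
in the complement of `A`. -/
def expTypeClass {d : ℕ} (A : Set (EuclideanSpace ℝ (Fin d))) :
    Set (EuclideanSpace ℝ (Fin d) → ℂ) :=
  {ψ | IsEntireExpType ψ ∧ (∃ (C : ℝ) (N : ℕ), ∀ u, ‖ψ u‖ ≤ C * (1 + ‖u‖) ^ N) ∧
    ∀ φ ∈ testFunctions Aᶜ, ∫ u, fourierHat φ u * ψ u = 0}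

/-- The condition `∫ |ψ|² s⁻¹ < ∞`, with `1/0 = ∞` (and `0 · ∞ = 0`). -/
def SqIntegrableInv {d : ℕ} (s : EuclideanSpace ℝ (Fin d) → ENNReal)
    (ψ : EuclideanSpace ℝ (Fin d) → ℂ) : Prop :=
  ∫⁻ u, ‖ψ u‖ₑ ^ 2 * (s u)⁻¹ < ⊤

/-- The Fourier transform, in the sense of tempered distributions, of the function `ψ` of
polynomial growth is the square-integrable function `g`: `∫ φ g = ∫ φ̂ ψ` for every test
function `φ`. -/
def IsL2Fourier {d : ℕ} (ψ g : EuclideanSpace ℝ (Fin d) → ℂ) : Prop :=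
  MemLp g 2 volume ∧
    ∀ φ ∈ testFunctions (Set.univ : Set (EuclideanSpace ℝ (Fin d))),
      ∫ t, φ t * g t = ∫ u, fourierHat φ u * ψ u

/-- `φ` is orthogonal in `L²(S)` to every `ĥ` with `h ∈ C_c^∞(Aᶜ)`. -/
def IsOrthogonalOutside {d : ℕ} (S : Measure (EuclideanSpace ℝ (Fin d)))
    (A : Set (EuclideanSpace ℝ (Fin d))) (φ : EuclideanSpace ℝ (Fin d) → ℂ) : Prop :=
  ∀ h ∈ testFunctions Aᶜ, ∫ u, conj (φ u) * fourierHat h u ∂S = 0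

/-- In `L²(S)`, `φ` is the function `ρ s⁻¹`, where `s` is the spectral density: `φ = ρ / s` almost
everywhere for the absolutely continuous part `s(u) du` of `S`, and `φ = 0` almost everywhere for
the singular part of `S`. -/
def IsDivDensity {d : ℕ} (S : Measure (EuclideanSpace ℝ (Fin d)))
    (φ ρ : EuclideanSpace ℝ (Fin d) → ℂ) : Prop :=
  (∀ᵐ u ∂(volume.withDensity (spectralDensity S)),
    φ u = ρ u / ((spectralDensity S u).toReal : ℂ)) ∧
  ∀ᵐ u ∂(S.singularPart volume), φ u = 0

end

/-
If `S` is the spectral measure of `M`, then `f̂ ∈ L²(S)` for every bounded `f` supported in a fixed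
ball, so by the closed graph theorem `∫ |f̂|² dS` is bounded in terms of the uniform norm of `f`.
Testing this on the modulations of one bump function shows that the unit balls have uniformly
bounded `S`-mass. Conversely this translation boundedness gives, for each compact `K`, the estimate
`∫ |f̂|² dS ≤ C_K ∫ |f|²` for `f` supported in `K`.

Let `φ ∈ L²(S)` be orthogonal to `ĥ` for all test functions `h` supported off `A`. By the estimate,
`f ↦ ∫ φ̄ f̂ dS` is represented on bounded sets by an `L²` function `g`, which vanishes off `A` by
orthogonality. Its inverse Fourier transform `ψ` is entire of exponential type, with spectrum in
`A`, and uniqueness of Fourier transforms turns `∫ φ̄ f̂ dS = ∫ f g` into an equality of measures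
`φ̄ dS = ψ du`. So `φ` vanishes on the singular part of `S` and equals `ψ̄ / s` elsewhere.

Rigidity says that the Fourier transform of `1_A γ` lies in the closure of the `ĥ`, that is, is
orthogonal to all such `φ`; since `∫ φ̄ f̂ dS = ∫ f ψ̂`, this is an orthogonality relation between
`γ` and `ψ̂`. Evenness of `S` allows `γ` to be replaced by `γ̄` in the variance.
-/

open Filter Metric
open scoped ENNReal FourierTransform NNReal Topology

noncomputable section

section Fourier

variable {d : ℕ} {f g h : EuclideanSpace ℝ (Fin d) → ℂ} {U : Set (EuclideanSpace ℝ (Fin d))}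

theorem norm_exp_neg_I_mul_ofReal (x : ℝ) : ‖Complex.exp (-(Complex.I * (x : ℂ)))‖ = 1 := by
  simp [Complex.norm_exp]

theorem fourierHat_def (f : EuclideanSpace ℝ (Fin d) → ℂ) (u : EuclideanSpace ℝ (Fin d)) :
    fourierHat f u = ∫ t, Complex.exp (-(Complex.I * ((inner ℝ u t : ℝ) : ℂ))) * f t :=
  rfl

theorem fourierHat_eq_fourier (f : EuclideanSpace ℝ (Fin d) → ℂ) (u : EuclideanSpace ℝ (Fin d)) :
    fourierHat f u = 𝓕 f ((2 * Real.pi)⁻¹ • u) := by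
  rw [Real.fourier_eq', fourierHat]
  refine integral_congr_ae (.of_forall fun t => ?_)
  simp only [smul_eq_mul, inner_smul_right, real_inner_comm u t]
  congr 2
  push_cast
  field_simp

theorem integrable_exp_mul {μ : Measure (EuclideanSpace ℝ (Fin d))} (hf : Integrable f μ)
    (u : EuclideanSpace ℝ (Fin d)) :
    Integrable (fun t => Complex.exp (-(Complex.I * ((inner ℝ u t : ℝ) : ℂ))) * f t) μ :=
  hf.bdd_mul (Continuous.aestronglyMeasurable (by fun_prop))
    (.of_forall fun _ => (norm_exp_neg_I_mul_ofReal _).le)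

theorem norm_fourierHat_le (f : EuclideanSpace ℝ (Fin d) → ℂ) (u : EuclideanSpace ℝ (Fin d)) :
    ‖fourierHat f u‖ ≤ ∫ t, ‖f t‖ := by
  simpa only [norm_mul, norm_exp_neg_I_mul_ofReal, one_mul] using!
    norm_integral_le_integral_norm fun t =>
      Complex.exp (-(Complex.I * ((inner ℝ u t : ℝ) : ℂ))) * f t

theorem continuous_fourierHat (hf : Integrable f) : Continuous (fourierHat f) := by
  refine continuous_of_dominated (fun u => (integrable_exp_mul hf u).1)
    (fun u => .of_forall fun t => ?_) hf.norm (.of_forall fun t => by fun_prop)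
  rw [norm_mul, norm_exp_neg_I_mul_ofReal, one_mul]

theorem measurable_enorm_fourierHat_sq (hf : Integrable f) :
    Measurable fun u => ‖fourierHat f u‖ₑ ^ 2 :=
  (continuous_fourierHat hf).measurable.enorm.pow_const 2

theorem fourierHat_congr_ae (h : f =ᵐ[volume] g) : fourierHat f = fourierHat g :=
  funext fun _ => integral_congr_ae (h.mono fun t ht => by simp only [ht])

theorem fourierHat_add (hf : Integrable f) (hg : Integrable g) :
    fourierHat (f + g) = fourierHat f + fourierHat g := by
  ext u
  simp only [fourierHat, Pi.add_apply, mul_add]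
  exact integral_add (integrable_exp_mul hf u) (integrable_exp_mul hg u)

theorem fourierHat_sub (hf : Integrable f) (hg : Integrable g) :
    fourierHat (f - g) = fourierHat f - fourierHat g := by
  ext u
  simp only [fourierHat, Pi.sub_apply, mul_sub]
  exact integral_sub (integrable_exp_mul hf u) (integrable_exp_mul hg u)

theorem fourierHat_smul (c : ℂ) (f : EuclideanSpace ℝ (Fin d) → ℂ) :
    fourierHat (c • f) = c • fourierHat f := by
  ext u
  simp only [fourierHat, Pi.smul_apply, smul_eq_mul, ← integral_const_mul, mul_left_comm c]

theorem fourierHat_conj (f : EuclideanSpace ℝ (Fin d) → ℂ) (u : EuclideanSpace ℝ (Fin d)) :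
    fourierHat (fun t => conj (f t)) u = conj (fourierHat f (-u)) := by
  simp only [fourierHat, ← integral_conj, map_mul, ← Complex.exp_conj]
  simp

theorem fourierHat_comp_neg (f : EuclideanSpace ℝ (Fin d) → ℂ) (u : EuclideanSpace ℝ (Fin d)) :
    fourierHat (fun t => f (-t)) u = fourierHat f (-u) := by
  rw [fourierHat_def, ← integral_neg_eq_self]
  simp [fourierHat_def]

theorem fourierHat_exp_mul (f : EuclideanSpace ℝ (Fin d) → ℂ) (a u : EuclideanSpace ℝ (Fin d)) :
    fourierHat (fun t => Complex.exp (Complex.I * ((inner ℝ a t : ℝ) : ℂ)) * f t) u =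
      fourierHat f (u - a) := by
  refine integral_congr_ae (.of_forall fun t => ?_)
  simp only [← mul_assoc, ← Complex.exp_add, inner_sub_left]
  congr 2
  push_cast
  ring

theorem fourierHat_comp_sub (f : EuclideanSpace ℝ (Fin d) → ℂ) (a u : EuclideanSpace ℝ (Fin d)) :
    fourierHat (fun t => f (t - a)) u =
      Complex.exp (-(Complex.I * ((inner ℝ a u : ℝ) : ℂ))) * fourierHat f u := by
  rw [fourierHat_def, ← integral_add_right_eq_self _ a, fourierHat_def, ← integral_const_mul]
  refine integral_congr_ae (.of_forall fun t => ?_)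
  simp only [add_sub_cancel_right]
  rw [← mul_assoc, ← Complex.exp_add, inner_add_right, real_inner_comm u a]
  congr 2
  push_cast
  ring

theorem integral_fourierHat_mul_eq_flip {μ : Measure (EuclideanSpace ℝ (Fin d))} [SFinite μ]
    (hf : Integrable f) (hg : Integrable g μ) :
    ∫ u, fourierHat f u * g u ∂μ =
      ∫ t, f t * ∫ u, Complex.exp (-(Complex.I * ((inner ℝ t u : ℝ) : ℂ))) * g u ∂μ := by
  simp only [fourierHat, ← integral_mul_const, ← integral_const_mul]
  rw [integral_integral_swap]
  · refine integral_congr_ae (.of_forall fun t => integral_congr_ae (.of_forall fun u => ?_))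
    simp only [real_inner_comm u t]
    ring
  · refine ((hg.mul_prod hf).bdd_mul (f := fun p : EuclideanSpace ℝ (Fin d) × _ =>
      Complex.exp (-(Complex.I * ((inner ℝ p.1 p.2 : ℝ) : ℂ))))
      (Continuous.aestronglyMeasurable (by fun_prop))
      (.of_forall fun _ => (norm_exp_neg_I_mul_ofReal _).le)).congr (.of_forall fun p => ?_)
    simp only [Function.uncurry]
    ring

theorem integral_mul_fourierHat (hf : Integrable f) (hg : Integrable g) :
    ∫ u, f u * fourierHat g u = ∫ t, fourierHat f t * g t :=
  (integral_fourierHat_mul_eq_flip hf hg).symm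

theorem IsBddCompact.integrable {F : Type*} [NormedAddCommGroup F] [MeasurableSpace F]
    [BorelSpace F] [SecondCountableTopology F] {f : EuclideanSpace ℝ (Fin d) → F}
    (hf : IsBddCompact f) : Integrable f := by
  obtain ⟨hm, ⟨C, hC⟩, hs⟩ := hf
  have : IntegrableOn f (tsupport f) :=
    Measure.integrableOn_of_bounded (M := C) hs.isCompact.measure_lt_top.ne
      hm.aestronglyMeasurable (.of_forall hC)
  exact (integrableOn_iff_integrable_of_support_subset (subset_tsupport f)).1 this

theorem IsBddCompact.memLp_two (hf : IsBddCompact f) : MemLp f 2 volume :=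
  let ⟨_, ⟨_, hC⟩, _⟩ := hf
  (memLp_two_iff_integrable_sq_norm hf.integrable.1).2 <| by
    simpa only [sq] using hf.integrable.norm.bdd_mul hf.integrable.1.norm
      (.of_forall fun x => (norm_norm (f x)).trans_le (hC x))

theorem IsBddCompact.of_mem_testFunctions (hh : h ∈ testFunctions U) : IsBddCompact h :=
  ⟨hh.1.continuous.measurable, hh.1.continuous.bounded_above_of_compact_support hh.2.1, hh.2.1⟩

theorem IsBddCompact.sub (hf : IsBddCompact f) (hg : IsBddCompact g) : IsBddCompact (f - g) :=
  let ⟨hfm, ⟨C, hC⟩, hfs⟩ := hf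
  let ⟨hgm, ⟨D, hD⟩, hgs⟩ := hg
  ⟨hfm.sub hgm, ⟨C + D, fun x => (norm_sub_le _ _).trans (add_le_add (hC x) (hD x))⟩,
    hfs.sub hgs⟩

theorem IsBddCompact.re (hf : IsBddCompact f) : IsBddCompact fun x => (f x).re :=
  let ⟨hm, ⟨C, hC⟩, hs⟩ := hf
  ⟨Complex.measurable_re.comp hm, ⟨C, fun x => (Complex.abs_re_le_norm _).trans (hC x)⟩,
    hs.comp_left Complex.zero_re⟩

theorem IsBddCompact.im (hf : IsBddCompact f) : IsBddCompact fun x => (f x).im :=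
  let ⟨hm, ⟨C, hC⟩, hs⟩ := hf
  ⟨Complex.measurable_im.comp hm, ⟨C, fun x => (Complex.abs_im_le_norm _).trans (hC x)⟩,
    hs.comp_left Complex.zero_im⟩

theorem IsBddCompact.conj (hf : IsBddCompact f) : IsBddCompact fun x => conj (f x) :=
  let ⟨hm, ⟨C, hC⟩, hs⟩ := hf
  ⟨Complex.continuous_conj.measurable.comp hm, ⟨C, fun x => by simpa using hC x⟩,
    hs.comp_left (map_zero _)⟩

theorem IsBddCompact.bcf_mul (hf : IsBddCompact f)
    (b : BoundedContinuousFunction (EuclideanSpace ℝ (Fin d)) ℂ) :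
    IsBddCompact fun x => b x * f x :=
  let ⟨hm, ⟨C, hC⟩, hs⟩ := hf
  ⟨b.continuous.measurable.mul hm, ⟨‖b‖ * C, fun x => (norm_mul_le _ _).trans
    (mul_le_mul (b.norm_coe_le_norm x) (hC x) (norm_nonneg _) (norm_nonneg _))⟩, hs.mul_left⟩

theorem IsBddCompact.indicator (hf : IsBddCompact f) {A : Set (EuclideanSpace ℝ (Fin d))}
    (hA : MeasurableSet A) : IsBddCompact (A.indicator f) :=
  let ⟨hm, ⟨C, hC⟩, hs⟩ := hf
  ⟨hm.indicator hA, ⟨C, fun x => (norm_indicator_le_norm_self _ _).trans (hC x)⟩,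
    hs.mono (by rw [Set.support_indicator]; exact Set.inter_subset_right)⟩

theorem ofReal_contDiffBump_mem_testFunctions {c : EuclideanSpace ℝ (Fin d)} (b : ContDiffBump c) :
    (fun t => (b t : ℂ)) ∈ testFunctions Set.univ :=
  ⟨Complex.ofRealCLM.contDiff.comp b.contDiff, b.hasCompactSupport.comp_left Complex.ofReal_zero,
    Set.subset_univ _⟩

theorem comp_sub_mem_testFunctions (hh : h ∈ testFunctions Set.univ)
    (a : EuclideanSpace ℝ (Fin d)) : (fun t => h (t - a)) ∈ testFunctions Set.univ :=
  ⟨hh.1.comp (contDiff_id.sub contDiff_const), hh.2.1.comp_homeomorph (Homeomorph.subRight a),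
    Set.subset_univ _⟩

theorem mem_testFunctions_univ (hh : h ∈ testFunctions U) : h ∈ testFunctions Set.univ :=
  ⟨hh.1, hh.2.1, Set.subset_univ _⟩

theorem exists_schwartzMap_eq_fourierHat (hh : h ∈ testFunctions U) :
    ∃ F : SchwartzMap (EuclideanSpace ℝ (Fin d)) ℂ, ⇑F = fourierHat h := by
  refine ⟨SchwartzMap.compCLMOfContinuousLinearEquiv ℂ (ContinuousLinearEquiv.smulLeft
    (Units.mk0 (2 * Real.pi)⁻¹ (inv_ne_zero Real.two_pi_pos.ne')))
    (𝓕 (hh.2.1.toSchwartzMap hh.1)), ?_⟩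
  ext u
  rw [fourierHat_eq_fourier]
  rfl

theorem integrable_fourierHat (hh : h ∈ testFunctions U) : Integrable (fourierHat h) :=
  let ⟨F, hF⟩ := exists_schwartzMap_eq_fourierHat hh
  hF ▸ F.integrable

theorem integral_comp_two_pi_inv_smul (F : EuclideanSpace ℝ (Fin d) → ℂ) :
    ∫ u, F ((2 * Real.pi)⁻¹ • u) = ((2 * Real.pi) ^ d : ℝ) * ∫ u, F u := by
  rw [Measure.integral_comp_smul, finrank_euclideanSpace, Fintype.card_fin, inv_pow, inv_inv,
    abs_of_pos (by positivity), Complex.real_smul]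

theorem integral_exp_mul_fourierHat (hh : h ∈ testFunctions U) (t : EuclideanSpace ℝ (Fin d)) :
    ∫ u, Complex.exp (Complex.I * ((inner ℝ u t : ℝ) : ℂ)) * fourierHat h u =
      ((2 * Real.pi) ^ d : ℝ) * h t := by
  have hinv : 𝓕⁻ (𝓕 h) t = h t :=
    congrFun (hh.1.continuous.fourierInv_fourier_eq
      (IsBddCompact.of_mem_testFunctions hh).integrable
      (𝓕 (hh.2.1.toSchwartzMap hh.1) : SchwartzMap _ ℂ).integrable) t
  rw [← hinv, Real.fourierInv_eq', ← integral_comp_two_pi_inv_smul]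
  refine integral_congr_ae (.of_forall fun u => ?_)
  simp only [fourierHat_eq_fourier, smul_eq_mul, inner_smul_left, conj_trivial]
  congr 2
  push_cast
  field_simp

theorem fourierHat_fourierHat (hh : h ∈ testFunctions U) (t : EuclideanSpace ℝ (Fin d)) :
    fourierHat (fourierHat h) t = ((2 * Real.pi) ^ d : ℝ) * h (-t) := by
  rw [← integral_exp_mul_fourierHat hh]
  simp [fourierHat_def (fourierHat h), real_inner_comm t]

theorem fourierHat_mul_eq (hf : Integrable f) (hh : h ∈ testFunctions U)
    (v : EuclideanSpace ℝ (Fin d)) :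
    ((2 * Real.pi) ^ d : ℝ) * fourierHat (fun t => h t * f t) v =
      ∫ u, fourierHat h (v - u) * fourierHat f u := by
  set k : EuclideanSpace ℝ (Fin d) → ℂ :=
    fun t => Complex.exp (Complex.I * ((inner ℝ v t : ℝ) : ℂ)) * h (-t)
  have hk : k ∈ testFunctions Set.univ :=
    ⟨(contDiff_const.mul (Complex.ofRealCLM.contDiff.comp
      (contDiff_const.inner ℝ contDiff_id))).cexp.mul (hh.1.comp contDiff_neg),
      (hh.2.1.comp_homeomorph (Homeomorph.neg _)).mul_left, Set.subset_univ _⟩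
  have hkhat (u) : fourierHat k u = fourierHat h (v - u) := by
    rw [fourierHat_exp_mul (fun t => h (-t)), fourierHat_comp_neg, neg_sub]
  simp only [← hkhat]
  rw [integral_mul_fourierHat (integrable_fourierHat hk) hf, fourierHat_def, ← integral_const_mul]
  refine integral_congr_ae (.of_forall fun t => ?_)
  simp only [fourierHat_fourierHat hk, k, inner_neg_right, neg_neg, Complex.ofReal_neg, mul_neg]
  ring

theorem fourier_toLp_ae_eq (hf : Integrable f) (hf2 : MemLp f 2 volume) :
    (𝓕 (hf2.toLp f) : Lp ℂ 2 volume) =ᵐ[volume] 𝓕 f := by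
  refine ae_eq_of_integral_contDiff_smul_eq ((Lp.memLp _).locallyIntegrable one_le_two)
    (VectorFourier.fourierIntegral_continuous Real.continuous_fourierChar
      continuous_inner hf).locallyIntegrable fun g hg hgs => ?_
  have hgc : ContDiff ℝ ((⊤ : ℕ∞) : WithTop ℕ∞) fun x => (g x : ℂ) :=
    Complex.ofRealCLM.contDiff.comp hg
  have hgcs : HasCompactSupport fun x => (g x : ℂ) := hgs.comp_left Complex.ofReal_zero
  have hdistr : ∫ x, (g x : ℂ) * (𝓕 (hf2.toLp f) : Lp ℂ 2 volume) x =
      ∫ x, 𝓕 (fun x => (g x : ℂ)) x * hf2.toLp f x := by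
    have h := congrArg (fun T => T (hgcs.toSchwartzMap hgc))
      (Lp.fourier_toTemperedDistribution_eq (hf2.toLp f))
    simp only [TemperedDistribution.fourier_apply, Lp.toTemperedDistribution_apply,
      smul_eq_mul, SchwartzMap.fourier_coe] at h
    exact h.symm
  have hflip : ∫ x, 𝓕 (fun x => (g x : ℂ)) x * f x = ∫ x, (g x : ℂ) * 𝓕 f x := by
    simpa using! VectorFourier.integral_fourierIntegral_smul_eq_flip
      (L := innerₗ (EuclideanSpace ℝ (Fin d))) Real.continuous_fourierChar continuous_inner
      (hgc.continuous.integrable_of_hasCompactSupport hgcs) hf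
  simp only [Complex.real_smul]
  rw [hdistr, ← hflip]
  exact integral_congr_ae (hf2.coeFn_toLp.mono fun x hx => by simp only [hx])

theorem enorm_Lp_two_sq {α F : Type*} [MeasurableSpace α] {μ : Measure α} [NormedAddCommGroup F]
    (f : Lp F 2 μ) : ‖f‖ₑ ^ 2 = ∫⁻ x, ‖f x‖ₑ ^ 2 ∂μ := by
  rw [Lp.enorm_def, eLpNorm_eq_lintegral_rpow_enorm_toReal two_ne_zero ENNReal.ofNat_ne_top,
    ← ENNReal.rpow_natCast, ← ENNReal.rpow_mul]
  simp

theorem lintegral_enorm_fourierHat_sq (hf : Integrable f) (hf2 : MemLp f 2 volume) :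
    ∫⁻ u, ‖fourierHat f u‖ₑ ^ 2 = ENNReal.ofReal ((2 * Real.pi) ^ d) * ∫⁻ t, ‖f t‖ₑ ^ 2 := by
  have hplancherel : ∫⁻ u, ‖𝓕 f u‖ₑ ^ 2 = ∫⁻ t, ‖f t‖ₑ ^ 2 := by
    calc ∫⁻ u, ‖𝓕 f u‖ₑ ^ 2 = ‖𝓕 (hf2.toLp f)‖ₑ ^ 2 := by
          rw [enorm_Lp_two_sq]
          exact lintegral_congr_ae ((fourier_toLp_ae_eq hf hf2).mono fun u hu => by simp only [hu])
      _ = ‖hf2.toLp f‖ₑ ^ 2 := by rw [← ofReal_norm, Lp.norm_fourier_eq, ofReal_norm]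
      _ = ∫⁻ t, ‖f t‖ₑ ^ 2 := by
          rw [enorm_Lp_two_sq]
          exact lintegral_congr_ae (hf2.coeFn_toLp.mono fun t ht => by simp only [ht])
  have hpi : (2 * Real.pi)⁻¹ ≠ 0 := inv_ne_zero Real.two_pi_pos.ne'
  simp only [fourierHat_eq_fourier]
  rw [← (measurableEmbedding_const_smul₀ hpi).lintegral_map (fun u => ‖𝓕 f u‖ₑ ^ 2),
    Measure.map_addHaar_smul _ hpi, lintegral_smul_measure, hplancherel, finrank_euclideanSpace,
    Fintype.card_fin, inv_pow, inv_inv, abs_of_pos (by positivity), smul_eq_mul]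

end Fourier

section TranslationBounded

/-- Translation boundedness of a measure: all closed balls of radius one have uniformly bounded
mass. Spectral measures have this property, and it is all that the Fourier analysis below uses. -/
def IsTranslationBounded {E : Type*} [PseudoMetricSpace E] [MeasurableSpace E]
    (S : Measure E) : Prop :=
  ∃ C : ℝ≥0, ∀ u, S (closedBall u 1) ≤ C

theorem IsTranslationBounded.isLocallyFiniteMeasure {E : Type*} [PseudoMetricSpace E]
    [MeasurableSpace E] {S : Measure E} (hS : IsTranslationBounded S) :
    IsLocallyFiniteMeasure S :=
  let ⟨_, hC⟩ := hS
  ⟨fun u => ⟨closedBall u 1, closedBall_mem_nhds u one_pos, (hC u).trans_lt ENNReal.coe_lt_top⟩⟩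

theorem exists_norm_schwartzMap_le {E V : Type*} [NormedAddCommGroup E] [NormedSpace ℝ E]
    [NormedAddCommGroup V] [NormedSpace ℝ V] (F : SchwartzMap E V) (n : ℕ) :
    ∃ C : ℝ, ∀ v v', dist v v' ≤ 1 → ‖F v‖ ≤ C * (1 + ‖v'‖) ^ (-(n : ℝ)) := by
  obtain ⟨C, hC⟩ : ∃ C : ℝ, ∀ v, (1 + ‖v‖) ^ n * ‖F v‖ ≤ C :=
    ⟨_, fun v => by
      simpa using SchwartzMap.one_add_le_sup_seminorm_apply (𝕜 := ℝ) (m := (n, 0))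
        (le_refl n) (le_refl 0) F v⟩
  refine ⟨2 ^ n * C, fun v v' hvv' => ?_⟩
  have hle : 1 + ‖v'‖ ≤ 2 * (1 + ‖v‖) := by
    rw [dist_eq_norm] at hvv'
    linarith [norm_sub_norm_le v' v, norm_sub_rev v v', norm_nonneg v]
  rw [Real.rpow_neg (by positivity), Real.rpow_natCast, ← div_eq_mul_inv,
    le_div_iff₀ (by positivity)]
  calc ‖F v‖ * (1 + ‖v'‖) ^ n ≤ ‖F v‖ * (2 * (1 + ‖v‖)) ^ n := by gcongr
    _ = 2 ^ n * ((1 + ‖v‖) ^ n * ‖F v‖) := by rw [mul_pow]; ring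
    _ ≤ 2 ^ n * C := by gcongr; exact hC v

section Averaging

variable {E : Type*} [NormedAddCommGroup E] [NormedSpace ℝ E] [FiniteDimensional ℝ E]
  [MeasurableSpace E] [BorelSpace E] {S : Measure E}

theorem measure_closedBall_mul_lintegral_le [SFinite S] (ν : Measure E) [ν.IsAddHaarMeasure]
    {C : ℝ≥0∞} (hC : ∀ u, S (closedBall u 1) ≤ C) {F G : E → ℝ≥0∞} (hG : Measurable G)
    (hFG : ∀ v v', dist v v' ≤ 1 → F v ≤ G v') :
    ν (closedBall 0 1) * ∫⁻ v, F v ∂S ≤ C * ∫⁻ v, G v ∂ν := by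
  classical
  have hmeas : Measurable fun p : E × E => (closedBall p.1 1).indicator G p.2 := by
    have : (fun p : E × E => (closedBall p.1 1).indicator G p.2) =
        {p : E × E | dist p.2 p.1 ≤ 1}.indicator fun p => G p.2 :=
      rfl
    rw [this]
    exact (hG.comp measurable_snd).indicator (measurableSet_le (by fun_prop) measurable_const)
  calc ν (closedBall 0 1) * ∫⁻ v, F v ∂S
      = ∫⁻ v, ∫⁻ _ in closedBall v 1, F v ∂ν ∂S := by
        rw [← lintegral_const_mul' _ _ measure_closedBall_lt_top.ne]
        simp [Measure.addHaar_closedBall_center, mul_comm]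
    _ ≤ ∫⁻ v, ∫⁻ v', (closedBall v 1).indicator G v' ∂ν ∂S := by
        refine lintegral_mono fun v => ?_
        rw [lintegral_indicator measurableSet_closedBall]
        exact setLIntegral_mono hG fun v' hv' => hFG v v' (by rwa [dist_comm])
    _ = ∫⁻ v', ∫⁻ v, (closedBall v 1).indicator G v' ∂S ∂ν :=
        lintegral_lintegral_swap hmeas.aemeasurable
    _ = ∫⁻ v', G v' * S (closedBall v' 1) ∂ν := by
        refine lintegral_congr fun v' => ?_
        rw [← setLIntegral_const, ← lintegral_indicator measurableSet_closedBall]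
        simp only [Set.indicator_apply, mem_closedBall, dist_comm]
    _ ≤ C * ∫⁻ v, G v ∂ν := by
        rw [← lintegral_const_mul _ hG]
        exact lintegral_mono fun v' => by rw [mul_comm]; gcongr; exact hC v'

theorem IsTranslationBounded.exists_lintegral_schwartzMap_sub_le (hS : IsTranslationBounded S)
    {V : Type*} [NormedAddCommGroup V] [NormedSpace ℝ V] (F : SchwartzMap E V) :
    ∃ C : ℝ≥0, ∀ u, ∫⁻ v, ‖F (v - u)‖ₑ ∂S ≤ C := by
  have := hS.isLocallyFiniteMeasure
  obtain ⟨C, hC⟩ := hS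
  let ν : Measure E := Measure.addHaar
  let n := Module.finrank ℝ E + 1
  obtain ⟨K, hFK⟩ := exists_norm_schwartzMap_le F n
  have hint : ∫⁻ v, ENNReal.ofReal (K * (1 + ‖v‖) ^ (-(n : ℝ))) ∂ν ≠ ⊤ :=
    ((integrable_one_add_norm (by simp [n])).const_mul K).lintegral_lt_top.ne
  have hball : ν (closedBall 0 1) ≠ 0 := (measure_closedBall_pos ν 0 one_pos).ne'
  refine ⟨(C * (∫⁻ v, ENNReal.ofReal (K * (1 + ‖v‖) ^ (-(n : ℝ))) ∂ν) /
    ν (closedBall 0 1)).toNNReal, fun u => ?_⟩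
  rw [ENNReal.coe_toNNReal (ENNReal.div_ne_top (ENNReal.mul_ne_top ENNReal.coe_ne_top hint) hball),
    ENNReal.le_div_iff_mul_le (.inl hball) (.inl measure_closedBall_lt_top.ne), mul_comm,
    ← lintegral_sub_right_eq_self (μ := ν) _ u]
  refine measure_closedBall_mul_lintegral_le ν hC (by fun_prop) fun v v' hvv' => ?_
  rw [← ofReal_norm]
  exact ENNReal.ofReal_le_ofReal (hFK _ _ (by rwa [dist_sub_right]))

end Averaging

theorem lintegral_lintegral_sub_mul_le {E : Type*} [AddGroup E] [MeasurableSpace E]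
    [MeasurableSub₂ E] {μ ν : Measure E} [SFinite μ] [SFinite ν] {w g : E → ℝ≥0∞} {C : ℝ≥0∞}
    (hw : Measurable w) (hg : Measurable g) (hC : ∀ u, ∫⁻ v, w (v - u) ∂μ ≤ C) :
    ∫⁻ v, (∫⁻ u, w (v - u) * g u ∂ν) ∂μ ≤ C * ∫⁻ u, g u ∂ν := by
  rw [lintegral_lintegral_swap (Measurable.aemeasurable (by fun_prop)), ← lintegral_const_mul _ hg]
  refine lintegral_mono fun u => ?_
  rw [lintegral_mul_const _ (by fun_prop)]
  exact mul_le_mul_left (hC u) (g u)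

theorem sq_lintegral_le {α : Type*} [MeasurableSpace α] {μ : Measure α} {f : α → ℝ≥0∞}
    (hf : AEMeasurable f μ) : (∫⁻ x, f x ∂μ) ^ 2 ≤ μ Set.univ * ∫⁻ x, f x ^ 2 ∂μ := by
  have h := ENNReal.lintegral_mul_le_Lp_mul_Lq μ Real.HolderConjugate.two_two
    (f := 1) aemeasurable_const hf
  simp only [Pi.one_apply, one_mul, ENNReal.one_rpow, lintegral_one, Pi.mul_apply] at h
  refine (pow_le_pow_left' h 2).trans_eq ?_
  rw [mul_pow, ← ENNReal.rpow_natCast, ← ENNReal.rpow_natCast, ← ENNReal.rpow_mul,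
    ← ENNReal.rpow_mul]
  simp

theorem sq_lintegral_mul_le {α : Type*} [MeasurableSpace α] {μ : Measure α} {w f : α → ℝ≥0∞}
    (hw : Measurable w) (hf : Measurable f) :
    (∫⁻ x, w x * f x ∂μ) ^ 2 ≤ (∫⁻ x, w x ∂μ) * ∫⁻ x, w x * f x ^ 2 ∂μ := by
  have h := sq_lintegral_le (μ := μ.withDensity w) hf.aemeasurable
  simpa [lintegral_withDensity_eq_lintegral_mul _ hw hf,
    lintegral_withDensity_eq_lintegral_mul _ hw (hf.pow_const 2)] using h

variable {d : ℕ}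

theorem exists_cutoff {K : Set (EuclideanSpace ℝ (Fin d))} (hK : IsCompact K) :
    ∃ χ ∈ testFunctions Set.univ, ∃ U : Set (EuclideanSpace ℝ (Fin d)), IsOpen U ∧ K ⊆ U ∧
      ∀ t ∈ U, χ t = 1 := by
  obtain ⟨R, hR0, hR⟩ := hK.isBounded.subset_ball_lt 0 0
  let b : ContDiffBump (0 : EuclideanSpace ℝ (Fin d)) := ⟨R, R + 1, hR0, lt_add_one R⟩
  refine ⟨_, ofReal_contDiffBump_mem_testFunctions b, ball 0 R, isOpen_ball, hR, fun t ht => ?_⟩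
  rw [b.one_of_mem_closedBall (ball_subset_closedBall ht), Complex.ofReal_one]

theorem sq_enorm_fourierHat_mul_le {f h : EuclideanSpace ℝ (Fin d) → ℂ} (hf : Integrable f)
    (hh : h ∈ testFunctions Set.univ) (v : EuclideanSpace ℝ (Fin d)) :
    ENNReal.ofReal ((2 * Real.pi) ^ d) ^ 2 * ‖fourierHat (fun t => h t * f t) v‖ₑ ^ 2 ≤
      (∫⁻ u, ‖fourierHat h u‖ₑ) * ∫⁻ u, ‖fourierHat h (v - u)‖ₑ * ‖fourierHat f u‖ₑ ^ 2 := by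
  have hhc := continuous_fourierHat (IsBddCompact.of_mem_testFunctions hh).integrable
  calc _ = ‖∫ u, fourierHat h (v - u) * fourierHat f u‖ₑ ^ 2 := by
        rw [← fourierHat_mul_eq hf hh, enorm_mul, ← ofReal_norm (Complex.ofReal _),
          Complex.norm_of_nonneg (by positivity), mul_pow (ENNReal.ofReal _)]
    _ ≤ (∫⁻ u, ‖fourierHat h (v - u)‖ₑ * ‖fourierHat f u‖ₑ) ^ 2 := by
        gcongr
        simpa only [enorm_mul] using
          enorm_integral_le_lintegral_enorm fun u => fourierHat h (v - u) * fourierHat f u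
    _ ≤ _ := by
        rw [← lintegral_sub_left_eq_self (fun u => ‖fourierHat h u‖ₑ) v]
        exact sq_lintegral_mul_le (by fun_prop : Continuous _).measurable.enorm
          (continuous_fourierHat hf).measurable.enorm

theorem IsTranslationBounded.exists_lintegral_fourierHat_sq_le
    {S : Measure (EuclideanSpace ℝ (Fin d))} (hS : IsTranslationBounded S)
    {K : Set (EuclideanSpace ℝ (Fin d))} (hK : IsCompact K) :
    ∃ C : ℝ≥0, ∀ f : EuclideanSpace ℝ (Fin d) → ℂ, Integrable f → MemLp f 2 volume →
      (∀ t ∉ K, f t = 0) → ∫⁻ u, ‖fourierHat f u‖ₑ ^ 2 ∂S ≤ C * ∫⁻ t, ‖f t‖ₑ ^ 2 := by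
  have := hS.isLocallyFiniteMeasure
  obtain ⟨χ, hχ, U, -, hKU, hU⟩ := exists_cutoff hK
  obtain ⟨F, hF⟩ := exists_schwartzMap_eq_fourierHat hχ
  obtain ⟨C, hC⟩ := hS.exists_lintegral_schwartzMap_sub_le F
  have hχc := continuous_fourierHat (IsBddCompact.of_mem_testFunctions hχ).integrable
  set c : ℝ≥0∞ := ENNReal.ofReal ((2 * Real.pi) ^ d)
  have hc : c ≠ 0 := (ENNReal.ofReal_pos.2 (by positivity)).ne'
  set I : ℝ≥0∞ := ∫⁻ u, ‖fourierHat χ u‖ₑ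
  have hI : I ≠ ⊤ := (integrable_fourierHat hχ).2.ne
  refine ⟨(I * C / c).toNNReal, fun f hf hf2 hfK => ?_⟩
  have hχf : (fun t => χ t * f t) = f := by
    ext t
    by_cases ht : t ∈ K
    · rw [hU t (hKU ht), one_mul]
    · rw [hfK t ht, mul_zero]
  have key : c ^ 2 * ∫⁻ v, ‖fourierHat f v‖ₑ ^ 2 ∂S ≤ I * (C * (c * ∫⁻ t, ‖f t‖ₑ ^ 2)) :=
    calc c ^ 2 * ∫⁻ v, ‖fourierHat f v‖ₑ ^ 2 ∂S
        ≤ ∫⁻ v, I * (∫⁻ u, ‖fourierHat χ (v - u)‖ₑ * ‖fourierHat f u‖ₑ ^ 2) ∂S := by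
          rw [← lintegral_const_mul _ (measurable_enorm_fourierHat_sq hf)]
          refine lintegral_mono fun v => ?_
          simpa only [hχf] using sq_enorm_fourierHat_mul_le hf hχ v
      _ ≤ I * (C * ∫⁻ u, ‖fourierHat f u‖ₑ ^ 2) := by
          rw [lintegral_const_mul' _ _ hI]
          gcongr
          exact lintegral_lintegral_sub_mul_le hχc.measurable.enorm
            (measurable_enorm_fourierHat_sq hf) fun u => by simpa only [hF] using hC u
      _ = I * (C * (c * ∫⁻ t, ‖f t‖ₑ ^ 2)) := by rw [lintegral_enorm_fourierHat_sq hf hf2]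
  rw [ENNReal.coe_toNNReal (ENNReal.div_ne_top (ENNReal.mul_ne_top hI ENNReal.coe_ne_top) hc),
    ← ENNReal.mul_le_mul_iff_right (pow_ne_zero 2 hc) (ENNReal.pow_ne_top ENNReal.ofReal_ne_top)]
  refine key.trans_eq ?_
  rw [sq, mul_assoc c c, ← mul_assoc c (_ / c), ENNReal.mul_div_cancel hc ENNReal.ofReal_ne_top]
  ring

end TranslationBounded

section Uniqueness

variable {d : ℕ} {S : Measure (EuclideanSpace ℝ (Fin d))}

theorem mul_integral_le_norm_fourierHat {b : EuclideanSpace ℝ (Fin d) → ℝ} (hb : Integrable b)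
    (hb0 : ∀ t, 0 ≤ b t) {r : ℝ} (hr : ∀ t, r ≤ ‖t‖ → b t = 0) (u : EuclideanSpace ℝ (Fin d)) :
    (1 - r * ‖u‖) * ∫ t, b t ≤ ‖fourierHat (fun t => (b t : ℂ)) u‖ := by
  have hbc : Integrable fun t => (b t : ℂ) := hb.ofReal
  have hpoint (t) : ‖Complex.exp (-(Complex.I * ((inner ℝ u t : ℝ) : ℂ))) * b t - b t‖ ≤
      r * ‖u‖ * b t := by
    rw [← sub_one_mul, norm_mul, Complex.norm_of_nonneg (hb0 t)]
    rcases le_or_gt r ‖t‖ with ht | ht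
    · simp [hr t ht]
    gcongr
    · exact hb0 t
    calc ‖Complex.exp (-(Complex.I * ((inner ℝ u t : ℝ) : ℂ))) - 1‖ ≤ ‖inner ℝ u t‖ := by
          simpa using Real.norm_exp_I_mul_ofReal_sub_one_le (x := -inner ℝ u t)
      _ ≤ ‖u‖ * ‖t‖ := norm_inner_le_norm u t
      _ ≤ r * ‖u‖ := by rw [mul_comm]; gcongr
  have hclose : ‖fourierHat (fun t => (b t : ℂ)) u - ∫ t, (b t : ℂ)‖ ≤ r * ‖u‖ * ∫ t, b t := by
    rw [fourierHat_def, ← integral_sub (integrable_exp_mul hbc u) hbc, ← integral_const_mul]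
    exact norm_integral_le_of_norm_le (hb.const_mul _) (.of_forall hpoint)
  have hnorm : ‖∫ t, (b t : ℂ)‖ = ∫ t, b t := by
    rw [integral_complex_ofReal, Complex.norm_of_nonneg (integral_nonneg hb0)]
  linarith [norm_sub_norm_le (∫ t, (b t : ℂ)) (fourierHat (fun t => (b t : ℂ)) u),
    norm_sub_rev (∫ t, (b t : ℂ)) (fourierHat (fun t => (b t : ℂ)) u)]

theorem mul_integral_contDiffBump_le (b : ContDiffBump (0 : EuclideanSpace ℝ (Fin d)))
    (u : EuclideanSpace ℝ (Fin d)) :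
    (1 - b.rOut * ‖u‖) * ∫ t, b t ≤ ‖fourierHat (fun t => (b t : ℂ)) u‖ :=
  mul_integral_le_norm_fourierHat b.integrable (fun _ => b.nonneg)
    (fun t ht => b.zero_of_le_dist (by rwa [dist_zero_right])) u

theorem exists_testFunctions_fourierHat_ne_zero (d : ℕ) :
    ∃ h : ℕ → EuclideanSpace ℝ (Fin d) → ℂ, (∀ n, h n ∈ testFunctions Set.univ) ∧
      ∀ u, ∃ n, fourierHat (h n) u ≠ 0 := by
  have hpos (n : ℕ) : 0 < ((n : ℝ) + 1)⁻¹ := by positivity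
  let b (n : ℕ) : ContDiffBump (0 : EuclideanSpace ℝ (Fin d)) :=
    ⟨((n : ℝ) + 1)⁻¹ / 2, ((n : ℝ) + 1)⁻¹, half_pos (hpos n), half_lt_self (hpos n)⟩
  refine ⟨fun n t => (b n t : ℂ), fun n => ofReal_contDiffBump_mem_testFunctions (b n),
    fun u => ?_⟩
  obtain ⟨n, hn⟩ := exists_nat_gt ‖u‖
  refine ⟨n, norm_pos_iff.1 ((mul_pos ?_ (b n).integral_pos).trans_le
    (mul_integral_contDiffBump_le (b n) u))⟩
  rw [sub_pos, ← div_eq_inv_mul, div_lt_one (by positivity)]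
  linarith

theorem exists_integrable_fourierHat_eq {h : EuclideanSpace ℝ (Fin d) → ℂ}
    {U : Set (EuclideanSpace ℝ (Fin d))} (hh : h ∈ testFunctions U) :
    ∃ k, Integrable k ∧ fourierHat k = h := by
  set c : ℂ := (((2 * Real.pi) ^ d : ℝ) : ℂ)
  have hc : c ≠ 0 := Complex.ofReal_ne_zero.2 (by positivity)
  refine ⟨c⁻¹ • fun t => fourierHat h (-t), (integrable_fourierHat hh).comp_neg.smul _, ?_⟩
  ext u
  rw [fourierHat_smul, Pi.smul_apply, fourierHat_comp_neg (fourierHat h), fourierHat_fourierHat hh,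
    neg_neg, smul_eq_mul, inv_mul_cancel_left₀ hc]

theorem ae_eq_zero_of_integral_exp_mul {μ : Measure (EuclideanSpace ℝ (Fin d))} [SFinite μ]
    {G : EuclideanSpace ℝ (Fin d) → ℂ} (hG : Integrable G μ)
    (h0 : ∀ a, ∫ u, Complex.exp (-(Complex.I * ((inner ℝ a u : ℝ) : ℂ))) * G u ∂μ = 0) :
    G =ᵐ[μ] 0 := by
  refine ae_eq_zero_of_integral_contDiff_smul_eq_zero hG.locallyIntegrable fun g hg hgs => ?_
  obtain ⟨k, hk, hkg⟩ := exists_integrable_fourierHat_eq (h := fun u => (g u : ℂ)) (U := Set.univ)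
    ⟨Complex.ofRealCLM.contDiff.comp hg, hgs.comp_left Complex.ofReal_zero, Set.subset_univ _⟩
  calc ∫ u, g u • G u ∂μ = ∫ u, fourierHat k u * G u ∂μ := by simp only [hkg, Complex.real_smul]
    _ = 0 := by simp [integral_fourierHat_mul_eq_flip hk hG, h0]

theorem ae_eq_zero_of_integral_fourierHat_mul {μ : Measure (EuclideanSpace ℝ (Fin d))} [SFinite μ]
    {G : EuclideanSpace ℝ (Fin d) → ℂ}
    (hi : ∀ h ∈ testFunctions Set.univ, Integrable (fun u => fourierHat h u * G u) μ)
    (h0 : ∀ h ∈ testFunctions Set.univ, ∫ u, fourierHat h u * G u ∂μ = 0) : G =ᵐ[μ] 0 := by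
  obtain ⟨h, hh, hne⟩ := exists_testFunctions_fourierHat_ne_zero d
  have hzero (n) : (fun u => fourierHat (h n) u * G u) =ᵐ[μ] 0 := by
    refine ae_eq_zero_of_integral_exp_mul (hi _ (hh n)) fun a => ?_
    simpa only [fourierHat_comp_sub, mul_assoc] using h0 _ (comp_sub_mem_testFunctions (hh n) a)
  filter_upwards [ae_all_iff.2 hzero] with u hu
  obtain ⟨n, hn⟩ := hne u
  exact (mul_eq_zero.1 (hu n)).resolve_left hn

theorem exists_ae_eq_of_mutuallySingular {α β : Type*} [MeasurableSpace α] {μ ν : Measure α}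
    (h : μ ⟂ₘ ν) (f g : α → β) : ∃ k : α → β, k =ᵐ[μ] f ∧ k =ᵐ[ν] g := by
  classical
  obtain ⟨N, -, hμ, hν⟩ := h
  exact ⟨N.piecewise g f,
    (measure_eq_zero_iff_ae_notMem.1 hμ).mono fun u hu => N.piecewise_eq_of_notMem g f hu,
    (measure_eq_zero_iff_ae_notMem.1 hν).mono fun u hu =>
      N.piecewise_eq_of_mem g f (not_not.1 hu)⟩

theorem measurable_spectralDensity (S : Measure (EuclideanSpace ℝ (Fin d))) :
    Measurable (spectralDensity S) :=
  Measure.measurable_rnDeriv _ _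

theorem singularPart_add_spectralDensity (S : Measure (EuclideanSpace ℝ (Fin d)))
    [SigmaFinite S] : S = S.singularPart volume + volume.withDensity (spectralDensity S) :=
  Measure.haveLebesgueDecomposition_add S volume

theorem spectralDensity_lt_top (S : Measure (EuclideanSpace ℝ (Fin d))) [SigmaFinite S] :
    ∀ᵐ u, spectralDensity S u < ⊤ :=
  Measure.rnDeriv_lt_top _ _

variable [SigmaFinite S]

theorem integrable_iff_spectralDensity {F : EuclideanSpace ℝ (Fin d) → ℂ} :
    Integrable F S ↔ Integrable F (S.singularPart volume) ∧
      Integrable fun u => ((spectralDensity S u).toReal : ℂ) * F u := by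
  conv_lhs => rw [singularPart_add_spectralDensity S]
  simp_rw [integrable_add_measure, integrable_withDensity_iff_integrable_smul'
    (measurable_spectralDensity S) (spectralDensity_lt_top S), Complex.real_smul]

theorem integral_eq_add_spectralDensity {F : EuclideanSpace ℝ (Fin d) → ℂ} (hF : Integrable F S) :
    ∫ u, F u ∂S = ∫ u, F u ∂(S.singularPart volume) +
      ∫ u, ((spectralDensity S u).toReal : ℂ) * F u := by
  have hF' := hF
  rw [singularPart_add_spectralDensity S, integrable_add_measure] at hF'
  conv_lhs => rw [singularPart_add_spectralDensity S]
  simp_rw [integral_add_measure hF'.1 hF'.2, integral_withDensity_eq_integral_toReal_smul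
    (measurable_spectralDensity S) (spectralDensity_lt_top S), Complex.real_smul]

theorem ae_eq_of_integral_fourierHat_eq {φ ψ : EuclideanSpace ℝ (Fin d) → ℂ}
    (hφ : ∀ h ∈ testFunctions Set.univ, Integrable (fun u => fourierHat h u * φ u) S)
    (hψ : ∀ h ∈ testFunctions Set.univ, Integrable fun u => fourierHat h u * ψ u)
    (heq : ∀ h ∈ testFunctions Set.univ,
      ∫ u, fourierHat h u * φ u ∂S = ∫ u, fourierHat h u * ψ u) :
    (∀ᵐ u, (spectralDensity S u).toReal * φ u = ψ u) ∧
      ∀ᵐ u ∂(S.singularPart volume), φ u = 0 := by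
  set T := S.singularPart volume
  set s := spectralDensity S
  obtain ⟨G, hGT, hGv⟩ := exists_ae_eq_of_mutuallySingular
    (S.mutuallySingular_singularPart volume) φ fun u => (s u).toReal * φ u - ψ u
  have hT (h : EuclideanSpace ℝ (Fin d) → ℂ) :
      (fun u => fourierHat h u * G u) =ᵐ[T] fun u => fourierHat h u * φ u :=
    hGT.mono fun u hu => by simp only [hu]
  have hv (h : EuclideanSpace ℝ (Fin d) → ℂ) : (fun u => fourierHat h u * G u) =ᵐ[volume]
      fun u => (s u).toReal * (fourierHat h u * φ u) - fourierHat h u * ψ u :=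
    hGv.mono fun u hu => by simp only [hu]; ring
  have hintT (h) (hh : h ∈ testFunctions Set.univ) : Integrable (fun u => fourierHat h u * G u) T :=
    (integrable_iff_spectralDensity.1 (hφ h hh)).1.congr (hT h).symm
  have hintv (h) (hh : h ∈ testFunctions Set.univ) : Integrable fun u => fourierHat h u * G u :=
    ((integrable_iff_spectralDensity.1 (hφ h hh)).2.sub (hψ h hh)).congr (hv h).symm
  have hG : G =ᵐ[T + volume] 0 := by
    refine ae_eq_zero_of_integral_fourierHat_mul
      (fun h hh => (hintT h hh).add_measure (hintv h hh)) fun h hh => ?_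
    rw [integral_add_measure (hintT h hh) (hintv h hh), integral_congr_ae (hT h),
      integral_congr_ae (hv h), integral_sub (integrable_iff_spectralDensity.1 (hφ h hh)).2
        (hψ h hh), ← heq h hh, integral_eq_add_spectralDensity (hφ h hh)]
    ring
  rw [Filter.EventuallyEq, ae_add_measure_iff] at hG
  exact ⟨by filter_upwards [hG.2, hGv] with u h0 hu using sub_eq_zero.1 (hu.symm.trans h0),
    by filter_upwards [hG.1, hGT] with u h0 hu using hu.symm.trans h0⟩

end Uniqueness

section Density

variable {d : ℕ} {S : Measure (EuclideanSpace ℝ (Fin d))} {φ ψ : EuclideanSpace ℝ (Fin d) → ℂ}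

theorem IsEntireExpType.continuous (hψ : IsEntireExpType ψ) : Continuous ψ := by
  obtain ⟨F, hF, -, h⟩ := hψ
  rw [funext h]
  exact hF.continuous.comp ((PiLp.continuous_toLp 2 _).comp (by fun_prop))

theorem SqIntegrableInv.ae_eq_zero (hψ : SqIntegrableInv (spectralDensity S) ψ)
    (hm : AEMeasurable ψ) : ∀ᵐ u, spectralDensity S u = 0 → ψ u = 0 := by
  filter_upwards [ae_lt_top' ((hm.enorm.pow_const 2).mul
    (measurable_spectralDensity S).inv.aemeasurable) hψ.ne] with u hu h0
  by_contra hne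
  simp [h0, ENNReal.mul_top, hne] at hu

variable [SigmaFinite S]

theorem isDivDensity_conj_iff (h0 : ∀ᵐ u, spectralDensity S u = 0 → ψ u = 0) :
    IsDivDensity S φ (fun u => conj (ψ u)) ↔
      (∀ᵐ u, (spectralDensity S u).toReal * conj (φ u) = ψ u) ∧
        ∀ᵐ u ∂(S.singularPart volume), φ u = 0 := by
  refine and_congr_left' ?_
  rw [ae_withDensity_iff (measurable_spectralDensity S)]
  refine eventually_congr ?_
  filter_upwards [h0, spectralDensity_lt_top S] with u h0 hfin
  rcases eq_or_ne (spectralDensity S u) 0 with hs | hs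
  · simp [hs, h0 hs]
  · have hne : ((spectralDensity S u).toReal : ℂ) ≠ 0 :=
      Complex.ofReal_ne_zero.2 (ENNReal.toReal_ne_zero.2 ⟨hs, hfin.ne⟩)
    rw [eq_div_iff hne, ← (starRingEnd ℂ).injective.eq_iff]
    simp [hs, mul_comm]

theorem lintegral_enorm_sq_eq_mul_inv
    (hac : ∀ᵐ u, (spectralDensity S u).toReal * conj (φ u) = ψ u)
    (hsing : ∀ᵐ u ∂(S.singularPart volume), φ u = 0) :
    ∫⁻ u, ‖φ u‖ₑ ^ 2 ∂S = ∫⁻ u, ‖ψ u‖ₑ ^ 2 * (spectralDensity S u)⁻¹ := by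
  have hzero : ∫⁻ u, ‖φ u‖ₑ ^ 2 ∂(S.singularPart volume) = 0 :=
    (lintegral_congr_ae (hsing.mono fun u hu => by simp [hu])).trans lintegral_zero
  conv_lhs => rw [singularPart_add_spectralDensity S]
  rw [lintegral_add_measure, hzero, zero_add,
    lintegral_withDensity_eq_lintegral_mul_non_measurable _ (measurable_spectralDensity S)
      (spectralDensity_lt_top S)]
  refine lintegral_congr_ae ?_
  filter_upwards [hac, spectralDensity_lt_top S] with u hu hfin
  rcases eq_or_ne (spectralDensity S u) 0 with hs | hs
  · simp [hs, ← hu]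
  · have hnorm : ‖((spectralDensity S u).toReal : ℂ)‖ₑ = spectralDensity S u := by
      rw [← ofReal_norm, Complex.norm_of_nonneg ENNReal.toReal_nonneg,
        ENNReal.ofReal_toReal hfin.ne]
    rw [← hu, enorm_mul, RCLike.enorm_conj, hnorm, Pi.mul_apply, mul_pow, mul_right_comm,
      sq (spectralDensity S u), mul_assoc _ _ (_)⁻¹, ENNReal.mul_inv_cancel hs hfin.ne, mul_one]

theorem integral_conj_mul_eq
    (hac : ∀ᵐ u, (spectralDensity S u).toReal * conj (φ u) = ψ u)
    (hsing : ∀ᵐ u ∂(S.singularPart volume), φ u = 0) {F : EuclideanSpace ℝ (Fin d) → ℂ}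
    (hF : Integrable (fun u => conj (φ u) * F u) S) :
    ∫ u, conj (φ u) * F u ∂S = ∫ u, F u * ψ u := by
  have hzero : ∫ u, conj (φ u) * F u ∂(S.singularPart volume) = 0 :=
    integral_eq_zero_of_ae (hsing.mono fun u hu => by simp [hu])
  rw [integral_eq_add_spectralDensity hF, hzero, zero_add]
  refine integral_congr_ae (hac.mono fun u hu => ?_)
  simp only [← hu]
  ring

theorem memLp_two_iff_lintegral {α : Type*} [MeasurableSpace α] {μ : Measure α} {f : α → ℂ}
    (hf : AEStronglyMeasurable f μ) : MemLp f 2 μ ↔ ∫⁻ x, ‖f x‖ₑ ^ 2 ∂μ < ⊤ := by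
  simp [MemLp, hf, eLpNorm_lt_top_iff_lintegral_rpow_enorm_lt_top]

theorem exists_memLp_spectralDensity_mul_conj_ae_eq (hm : AEMeasurable ψ)
    (hψ : SqIntegrableInv (spectralDensity S) ψ) :
    ∃ φ, MemLp φ 2 S ∧ (∀ᵐ u, (spectralDensity S u).toReal * conj (φ u) = ψ u) ∧
      ∀ᵐ u ∂(S.singularPart volume), φ u = 0 := by
  obtain ⟨φ, hsing, hv⟩ := exists_ae_eq_of_mutuallySingular
    (S.mutuallySingular_singularPart volume) (0 : EuclideanSpace ℝ (Fin d) → ℂ)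
    fun u => conj (ψ u) / ((spectralDensity S u).toReal : ℂ)
  obtain ⟨hac, -⟩ := (isDivDensity_conj_iff (hψ.ae_eq_zero hm)).1
    ⟨(withDensity_absolutelyContinuous _ _) hv, hsing⟩
  have hφm : AEStronglyMeasurable φ S := by
    have hvm : AEMeasurable (fun u => conj (ψ u) / ((spectralDensity S u).toReal : ℂ)) :=
      (Complex.continuous_conj.measurable.comp_aemeasurable hm).div
        (measurable_spectralDensity S).ennreal_toReal.complex_ofReal.aemeasurable
    rw [singularPart_add_spectralDensity S]
    exact (aestronglyMeasurable_zero.congr hsing.symm).add_measure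
      ((hvm.aestronglyMeasurable.congr hv.symm).mono_ac (withDensity_absolutelyContinuous _ _))
  refine ⟨φ, (memLp_two_iff_lintegral hφm).2 ?_, hac, hsing⟩
  rwa [lintegral_enorm_sq_eq_mul_inv hac hsing]

end Density

section PaleyWiener

variable {d : ℕ} {g : EuclideanSpace ℝ (Fin d) → ℂ} {A : Set (EuclideanSpace ℝ (Fin d))}

theorem continuous_toComplexSpace :
    Continuous (toComplexSpace : EuclideanSpace ℝ (Fin d) → EuclideanSpace ℂ (Fin d)) :=
  (PiLp.continuous_toLp 2 _).comp (by fun_prop)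

theorem norm_toComplexSpace (t : EuclideanSpace ℝ (Fin d)) : ‖toComplexSpace t‖ = ‖t‖ := by
  simp [EuclideanSpace.norm_eq, toComplexSpace]

theorem inner_toComplexSpace (t u : EuclideanSpace ℝ (Fin d)) :
    inner ℂ (toComplexSpace t) (toComplexSpace u) = ((inner ℝ u t : ℝ) : ℂ) := by
  simp [PiLp.inner_apply, toComplexSpace, mul_comm]

theorem norm_exp_neg_I_mul_inner_toComplexSpace_le (t : EuclideanSpace ℝ (Fin d))
    (z : EuclideanSpace ℂ (Fin d)) :
    ‖Complex.exp (-(Complex.I * inner ℂ (toComplexSpace t) z))‖ ≤ Real.exp (‖t‖ * ‖z‖) := by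
  refine (Complex.norm_exp_le_exp_norm _).trans (Real.exp_le_exp.2 ?_)
  simpa [norm_toComplexSpace] using norm_inner_le_norm (𝕜 := ℂ) (toComplexSpace t) z

/-- The extension of the Fourier transform `fourierHat g` to complex frequencies, meaningful for
`g` of compact support. -/
def fourierLaplace (g : EuclideanSpace ℝ (Fin d) → ℂ) (z : EuclideanSpace ℂ (Fin d)) : ℂ :=
  ∫ t, Complex.exp (-(Complex.I * inner ℂ (toComplexSpace t) z)) * g t

theorem norm_exp_mul_le {R : ℝ} (hR : ∀ t, R < ‖t‖ → g t = 0) (t : EuclideanSpace ℝ (Fin d))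
    (z : EuclideanSpace ℂ (Fin d)) :
    ‖Complex.exp (-(Complex.I * inner ℂ (toComplexSpace t) z)) * g t‖ ≤
      Real.exp (R * ‖z‖) * ‖g t‖ := by
  rw [norm_mul]
  rcases le_or_gt ‖t‖ R with ht | ht
  · gcongr
    exact (norm_exp_neg_I_mul_inner_toComplexSpace_le t z).trans (by gcongr)
  · simp [hR t ht]

theorem norm_fourierLaplace_le (hg : Integrable g) {R : ℝ} (hR : ∀ t, R < ‖t‖ → g t = 0)
    (z : EuclideanSpace ℂ (Fin d)) :
    ‖fourierLaplace g z‖ ≤ (∫ t, ‖g t‖) * Real.exp (R * ‖z‖) := by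
  rw [mul_comm, ← integral_const_mul]
  exact norm_integral_le_of_norm_le (hg.norm.const_mul _)
    (.of_forall fun t => norm_exp_mul_le hR t z)

theorem hasFDerivAt_exp_mul (c : ℂ) (t : EuclideanSpace ℝ (Fin d))
    (z : EuclideanSpace ℂ (Fin d)) :
    HasFDerivAt (fun z => Complex.exp (-(Complex.I * inner ℂ (toComplexSpace t) z)) * c)
      ((Complex.exp (-(Complex.I * inner ℂ (toComplexSpace t) z)) * c) •
        (-Complex.I) • innerSL ℂ (toComplexSpace t)) z := by
  have hinner : HasFDerivAt (fun z => -(Complex.I * inner ℂ (toComplexSpace t) z))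
      ((-Complex.I) • innerSL ℂ (toComplexSpace t)) z := by
    simpa only [← neg_mul] using! (innerSL ℂ (toComplexSpace t)).hasFDerivAt.const_mul (-Complex.I)
  simpa only [smul_smul, mul_assoc, mul_comm, mul_left_comm] using! hinner.cexp.mul_const c

theorem differentiable_fourierLaplace (hg : Integrable g) {R : ℝ}
    (hR : ∀ t, R < ‖t‖ → g t = 0) : Differentiable ℂ (fourierLaplace g) := by
  intro z₀
  have hmeas (z : EuclideanSpace ℂ (Fin d)) : AEStronglyMeasurable
      (fun t => Complex.exp (-(Complex.I * inner ℂ (toComplexSpace t) z)) * g t) volume := by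
    have := continuous_toComplexSpace (d := d)
    exact (Continuous.aestronglyMeasurable (by fun_prop)).mul hg.1
  let F' (z : EuclideanSpace ℂ (Fin d)) (t : EuclideanSpace ℝ (Fin d)) :
      EuclideanSpace ℂ (Fin d) →L[ℂ] ℂ :=
    (Complex.exp (-(Complex.I * inner ℂ (toComplexSpace t) z)) * g t) •
      (-Complex.I) • innerSL ℂ (toComplexSpace t)
  refine (hasFDerivAt_integral_of_dominated_of_fderiv_le (F' := F')
    (bound := fun t => Real.exp (|R| * (‖z₀‖ + 1)) * ‖g t‖ * |R|)
    (ball_mem_nhds z₀ one_pos) (.of_forall hmeas) ?_ ?_ (.of_forall fun t z hz => ?_)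
    ((hg.norm.const_mul _).mul_const _)
    (.of_forall fun t z _ => hasFDerivAt_exp_mul (g t) t z)).differentiableAt
  · exact (hg.norm.const_mul _).mono' (hmeas z₀) (.of_forall fun t => norm_exp_mul_le hR t z₀)
  · have hinner : Continuous fun t : EuclideanSpace ℝ (Fin d) => innerSL ℂ (toComplexSpace t) :=
      (innerSL ℂ).continuous.comp continuous_toComplexSpace
    exact (hmeas z₀).smul (hinner.const_smul (-Complex.I)).aestronglyMeasurable
  · rw [norm_smul, norm_smul, innerSL_apply_norm, norm_toComplexSpace, norm_neg, Complex.norm_I,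
      one_mul]
    rcases le_or_gt ‖t‖ R with ht | ht
    · have hz' : ‖z‖ ≤ ‖z₀‖ + 1 := by
        linarith [norm_le_norm_add_norm_sub' z z₀, mem_ball_iff_norm.1 hz]
      gcongr
      · refine (norm_exp_mul_le hR t z).trans ?_
        gcongr
        exact le_abs_self R
      · exact ht.trans (le_abs_self R)
    · simp [hR t ht]

theorem isEntireExpType_fourierHat (hg : Integrable g) (hA : Bornology.IsBounded A)
    (h0 : ∀ t ∉ A, g t = 0) : IsEntireExpType (fourierHat g) := by
  obtain ⟨R, hR⟩ := hA.exists_norm_le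
  have hR' (t) (ht : R < ‖t‖) : g t = 0 := h0 t fun htA => ht.not_ge (hR t htA)
  refine ⟨fourierLaplace g, differentiable_fourierLaplace hg hR',
    ⟨_, R, norm_fourierLaplace_le hg hR'⟩, fun u => ?_⟩
  simp only [fourierHat_def, fourierLaplace, inner_toComplexSpace]

/-- The inverse Fourier transform `(2π)⁻ᵈ ∫ e^{i⟨u,t⟩} g(t) dt` in the normalization of
`fourierHat`. -/
def fourierHatInv (g : EuclideanSpace ℝ (Fin d) → ℂ) (u : EuclideanSpace ℝ (Fin d)) : ℂ :=
  (((2 * Real.pi) ^ d : ℝ) : ℂ)⁻¹ * fourierHat g (-u)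

theorem continuous_fourierHatInv (hg : Integrable g) : Continuous (fourierHatInv g) :=
  continuous_const.mul ((continuous_fourierHat hg).comp continuous_neg)

theorem exists_norm_fourierHatInv_le (g : EuclideanSpace ℝ (Fin d) → ℂ) :
    ∃ C : ℝ, ∀ u, ‖fourierHatInv g u‖ ≤ C :=
  ⟨_, fun u => (norm_mul_le _ _).trans
    (mul_le_mul_of_nonneg_left (norm_fourierHat_le g (-u)) (norm_nonneg _))⟩

theorem integral_fourierHat_mul_fourierHatInv {h : EuclideanSpace ℝ (Fin d) → ℂ}
    {U : Set (EuclideanSpace ℝ (Fin d))} (hh : h ∈ testFunctions U) (hg : Integrable g) :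
    ∫ u, fourierHat h u * fourierHatInv g u = ∫ t, h t * g t := by
  have hc : (((2 * Real.pi) ^ d : ℝ) : ℂ) ≠ 0 := Complex.ofReal_ne_zero.2 (by positivity)
  calc ∫ u, fourierHat h u * fourierHatInv g u
      = (((2 * Real.pi) ^ d : ℝ) : ℂ)⁻¹ *
          ∫ u, fourierHat h u * fourierHat (fun t => g (-t)) u := by
        simp only [fourierHatInv, fourierHat_comp_neg, ← integral_const_mul, mul_left_comm]
    _ = (((2 * Real.pi) ^ d : ℝ) : ℂ)⁻¹ * ∫ t, fourierHat (fourierHat h) t * g (-t) := by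
        rw [integral_mul_fourierHat (integrable_fourierHat hh) hg.comp_neg]
    _ = ∫ t, h (-t) * g (-t) := by
        simp only [fourierHat_fourierHat hh, mul_assoc, integral_const_mul, inv_mul_cancel_left₀ hc]
    _ = ∫ t, h t * g t := integral_neg_eq_self (fun t => h t * g t) _

theorem isL2Fourier_fourierHatInv (hg : Integrable g) (hg2 : MemLp g 2 volume) :
    IsL2Fourier (fourierHatInv g) g :=
  ⟨hg2, fun _ hh => (integral_fourierHat_mul_fourierHatInv hh hg).symm⟩

theorem fourierHatInv_mem_expTypeClass (hg : Integrable g) (hA : IsCompact A)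
    (h0 : ∀ t ∉ A, g t = 0) : fourierHatInv g ∈ expTypeClass A := by
  refine ⟨?_, ?_, fun h hh => ?_⟩
  · have hfun : fourierHatInv g =
        fourierHat ((((2 * Real.pi) ^ d : ℝ) : ℂ)⁻¹ • fun t => g (-t)) := by
      ext u
      simp only [fourierHatInv, fourierHat_smul, Pi.smul_apply, fourierHat_comp_neg, smul_eq_mul]
    rw [hfun]
    exact isEntireExpType_fourierHat (hg.comp_neg.smul _) hA.neg.isBounded fun t ht => by
      simp [h0 (-t) (by simpa using ht)]
  · obtain ⟨C, hC⟩ := exists_norm_fourierHatInv_le g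
    exact ⟨C, 0, fun u => by simpa using hC u⟩
  · rw [integral_fourierHat_mul_fourierHatInv hh hg]
    refine integral_eq_zero_of_ae (.of_forall fun t => ?_)
    by_cases ht : t ∈ A
    · simp [image_eq_zero_of_notMem_tsupport fun hts => hh.2.2 hts ht]
    · simp [h0 t ht]

end PaleyWiener

section Representation

variable {d : ℕ} {S : Measure (EuclideanSpace ℝ (Fin d))} {φ f : EuclideanSpace ℝ (Fin d) → ℂ}
  {A K : Set (EuclideanSpace ℝ (Fin d))}

theorem inner_eq_integral_conj_mul {α : Type*} [MeasurableSpace α] {μ : Measure α}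
    {F G : Lp ℂ 2 μ} {f g : α → ℂ} (hF : F =ᵐ[μ] f) (hG : G =ᵐ[μ] g) :
    inner ℂ F G = ∫ x, conj (f x) * g x ∂μ := by
  rw [L2.inner_def]
  refine integral_congr_ae ?_
  filter_upwards [hF, hG] with x hFx hGx
  rw [hFx, hGx, RCLike.inner_apply, mul_comm]

/-- The linear map `v ↦ (f v)^` into `L²(S)`, for a family of integrable functions `f v` which
depends linearly on `v` up to null sets. -/
def fourierHatLp (S : Measure (EuclideanSpace ℝ (Fin d))) {V : Type*} [AddCommGroup V] [Module ℂ V]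
    (f : V → EuclideanSpace ℝ (Fin d) → ℂ) (hint : ∀ v, Integrable (f v))
    (hmem : ∀ v, MemLp (fourierHat (f v)) 2 S) (hadd : ∀ v w, f (v + w) =ᵐ[volume] f v + f w)
    (hsmul : ∀ (c : ℂ) v, f (c • v) =ᵐ[volume] c • f v) : V →ₗ[ℂ] Lp ℂ 2 S where
  toFun v := (hmem v).toLp (fourierHat (f v))
  map_add' v w := by
    rw [← MemLp.toLp_add]
    congr 1
    rw [fourierHat_congr_ae (hadd v w), fourierHat_add (hint v) (hint w)]
  map_smul' c v := by
    rw [RingHom.id_apply, ← MemLp.toLp_const_smul]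
    congr 1
    rw [fourierHat_congr_ae (hsmul c v), fourierHat_smul]

theorem coeFn_fourierHatLp {V : Type*} [AddCommGroup V] [Module ℂ V]
    {f : V → EuclideanSpace ℝ (Fin d) → ℂ} {hint : ∀ v, Integrable (f v)}
    {hmem : ∀ v, MemLp (fourierHat (f v)) 2 S} {hadd : ∀ v w, f (v + w) =ᵐ[volume] f v + f w}
    {hsmul : ∀ (c : ℂ) v, f (c • v) =ᵐ[volume] c • f v} (v : V) :
    fourierHatLp S f hint hmem hadd hsmul v =ᵐ[S] fourierHat (f v) :=
  (hmem v).coeFn_toLp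

theorem IsTranslationBounded.memLp_fourierHat (hS : IsTranslationBounded S) (hK : IsCompact K)
    (hf : Integrable f) (hf2 : MemLp f 2 volume) (hfK : ∀ t ∉ K, f t = 0) :
    MemLp (fourierHat f) 2 S := by
  obtain ⟨C, hC⟩ := hS.exists_lintegral_fourierHat_sq_le hK
  refine (memLp_two_iff_lintegral (continuous_fourierHat hf).aestronglyMeasurable).2
    ((hC f hf hf2 hfK).trans_lt (ENNReal.mul_lt_top ENNReal.coe_lt_top ?_))
  exact (memLp_two_iff_lintegral hf2.1).1 hf2

theorem IsTranslationBounded.memLp_fourierHat_of_isBddCompact (hS : IsTranslationBounded S)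
    (hf : IsBddCompact f) : MemLp (fourierHat f) 2 S :=
  hS.memLp_fourierHat hf.2.2 hf.integrable hf.memLp_two fun _ => image_eq_zero_of_notMem_tsupport

theorem integrable_indicator_of_memLp_two (hK : IsCompact K) (hf : MemLp f 2 volume) :
    Integrable (K.indicator f) :=
  have : IsFiniteMeasure (volume.restrict K) := ⟨by simpa using hK.measure_lt_top⟩
  (integrable_indicator_iff hK.measurableSet).2 (hf.restrict K |>.integrable one_le_two)

theorem IsTranslationBounded.exists_continuousLinearMap (hS : IsTranslationBounded S)
    (hK : IsCompact K) : ∃ T : Lp ℂ 2 (volume : Measure (EuclideanSpace ℝ (Fin d))) →L[ℂ] Lp ℂ 2 S,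
      ∀ v, T v =ᵐ[S] fourierHat (K.indicator v) := by
  obtain ⟨C, hC⟩ := hS.exists_lintegral_fourierHat_sq_le hK
  have hint (v : Lp ℂ 2 (volume : Measure (EuclideanSpace ℝ (Fin d)))) :
      Integrable (K.indicator v) := integrable_indicator_of_memLp_two hK (Lp.memLp v)
  have hint2 (v : Lp ℂ 2 (volume : Measure (EuclideanSpace ℝ (Fin d)))) :
      MemLp (K.indicator v) 2 volume := (Lp.memLp v).indicator hK.measurableSet
  have h0 (v : Lp ℂ 2 (volume : Measure (EuclideanSpace ℝ (Fin d)))) :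
      ∀ t ∉ K, K.indicator v t = 0 := fun t ht => Set.indicator_of_notMem ht _
  let T := fourierHatLp S (fun v : Lp ℂ 2 (volume : Measure (EuclideanSpace ℝ (Fin d))) =>
      K.indicator v) hint (fun v => hS.memLp_fourierHat hK (hint v) (hint2 v) (h0 v))
    (fun v w => (Lp.coeFn_add v w).indicator.trans (.of_eq (Set.indicator_add K v w)))
    (fun c v => (Lp.coeFn_smul c v).indicator.trans (.of_eq (Set.indicator_const_smul K c v)))
  have hT (v) : T v =ᵐ[S] fourierHat (K.indicator v) := coeFn_fourierHatLp v
  have hbound (v) : ‖T v‖ₑ ^ 2 ≤ C * ‖v‖ₑ ^ 2 := by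
    rw [enorm_Lp_two_sq, enorm_Lp_two_sq, lintegral_congr_ae ((hT v).mono fun u hu => by rw [hu])]
    refine (hC _ (hint v) (hint2 v) (h0 v)).trans ?_
    gcongr
    exact enorm_indicator_le_enorm_self _ _
  refine ⟨T.mkContinuous √C fun v => ?_, hT⟩
  rw [← Real.sqrt_sq (norm_nonneg v), ← Real.sqrt_mul (NNReal.coe_nonneg C)]
  refine Real.le_sqrt_of_sq_le ?_
  have := hbound v
  simp only [enorm_eq_nnnorm] at this
  exact_mod_cast this

theorem IsTranslationBounded.exists_integral_conj_mul_fourierHat_eq (hS : IsTranslationBounded S)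
    (hK : IsCompact K) (hφ : MemLp φ 2 S) :
    ∃ g, MemLp g 2 volume ∧ ∀ f, MemLp f 2 volume → (∀ t ∉ K, f t = 0) →
      ∫ u, conj (φ u) * fourierHat f u ∂S = ∫ t, f t * g t := by
  obtain ⟨T, hT⟩ := hS.exists_continuousLinearMap hK
  let g := ContinuousLinearMap.adjoint T (hφ.toLp φ)
  refine ⟨fun t => conj (g t), (Lp.memLp g).star, fun f hf hfK => ?_⟩
  have hTf : T (hf.toLp f) =ᵐ[S] fourierHat f := by
    refine (hT _).trans (.of_eq (fourierHat_congr_ae ?_))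
    filter_upwards [hf.coeFn_toLp] with t ht
    by_cases htK : t ∈ K <;> simp [htK, ht, hfK]
  calc ∫ u, conj (φ u) * fourierHat f u ∂S = inner ℂ (hφ.toLp φ) (T (hf.toLp f)) :=
        (inner_eq_integral_conj_mul hφ.coeFn_toLp hTf).symm
    _ = inner ℂ g (hf.toLp f) := (T.adjoint_inner_left _ _).symm
    _ = ∫ t, conj (g t) * f t := inner_eq_integral_conj_mul .rfl hf.coeFn_toLp
    _ = ∫ t, f t * conj (g t) := by simp only [mul_comm]

theorem sub_mul_mem_testFunctions {χ h : EuclideanSpace ℝ (Fin d) → ℂ}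
    {U V W : Set (EuclideanSpace ℝ (Fin d))} (hχ : χ ∈ testFunctions V) (hU : IsOpen U)
    (hAU : A ⊆ U) (hχU : ∀ t ∈ U, χ t = 1) (hh : h ∈ testFunctions W) :
    h - χ * h ∈ testFunctions Aᶜ := by
  refine ⟨hh.1.sub (hχ.1.mul hh.1), hh.2.1.sub hh.2.1.mul_left, ?_⟩
  have hsupp : Function.support (h - χ * h) ⊆ Uᶜ := fun t ht htU => ht (by simp [hχU t htU])
  exact (closure_minimal hsupp hU.isClosed_compl).trans (Set.compl_subset_compl.2 hAU)

theorem mul_mem_testFunctions {χ h : EuclideanSpace ℝ (Fin d) → ℂ}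
    {V W : Set (EuclideanSpace ℝ (Fin d))} (hχ : χ ∈ testFunctions V) (hh : h ∈ testFunctions W) :
    χ * h ∈ testFunctions W :=
  ⟨hχ.1.mul hh.1, hh.2.1.mul_left, tsupport_mul_subset_right.trans hh.2.2⟩

theorem IsTranslationBounded.integrable_conj_mul_fourierHat (hS : IsTranslationBounded S)
    (hφ : MemLp φ 2 S) (hf : IsBddCompact f) :
    Integrable (fun u => conj (φ u) * fourierHat f u) S :=
  hφ.star.integrable_mul (hS.memLp_fourierHat_of_isBddCompact hf)

theorem IsTranslationBounded.integral_conj_mul_fourierHat_cutoff (hS : IsTranslationBounded S)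
    (hφ : MemLp φ 2 S) (horth : IsOrthogonalOutside S A φ) {χ h : EuclideanSpace ℝ (Fin d) → ℂ}
    {U V W : Set (EuclideanSpace ℝ (Fin d))} (hχ : χ ∈ testFunctions V) (hU : IsOpen U)
    (hAU : A ⊆ U) (hχU : ∀ t ∈ U, χ t = 1) (hh : h ∈ testFunctions W) :
    ∫ u, conj (φ u) * fourierHat h u ∂S = ∫ u, conj (φ u) * fourierHat (χ * h) u ∂S := by
  have hhc : IsBddCompact h := .of_mem_testFunctions hh
  have hχh : IsBddCompact (χ * h) := .of_mem_testFunctions (mul_mem_testFunctions hχ hh)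
  have hsub := horth _ (sub_mul_mem_testFunctions hχ hU hAU hχU hh)
  simp only [fourierHat_sub hhc.integrable hχh.integrable, Pi.sub_apply, mul_sub] at hsub
  rwa [integral_sub (hS.integrable_conj_mul_fourierHat hφ hhc)
    (hS.integrable_conj_mul_fourierHat hφ hχh), sub_eq_zero] at hsub

theorem ae_eq_zero_compl_of_integral_testFunctions_mul {g : EuclideanSpace ℝ (Fin d) → ℂ}
    (hA : IsClosed A) (hg : LocallyIntegrable g)
    (h0 : ∀ h ∈ testFunctions Aᶜ, ∫ t, h t * g t = 0) : ∀ᵐ t, t ∉ A → g t = 0 := by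
  refine hA.isOpen_compl.ae_eq_zero_of_integral_contDiff_smul_eq_zero
    (hg.locallyIntegrableOn _) fun b hb hbs hbA => ?_
  simpa only [Complex.real_smul] using h0 (fun t => (b t : ℂ))
    ⟨Complex.ofRealCLM.contDiff.comp hb, hbs.comp_left Complex.ofReal_zero,
      (tsupport_comp_subset Complex.ofReal_zero b).trans hbA⟩

theorem IsTranslationBounded.exists_memLp_of_isOrthogonalOutside (hS : IsTranslationBounded S)
    (hA : IsCompact A) (hφ : MemLp φ 2 S) (horth : IsOrthogonalOutside S A φ) :
    ∃ g, MemLp g 2 volume ∧ (∀ t ∉ A, g t = 0) ∧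
      (∀ h ∈ testFunctions Set.univ, ∫ u, conj (φ u) * fourierHat h u ∂S = ∫ t, h t * g t) ∧
      ∀ f, MemLp f 2 volume → (∀ t ∉ A, f t = 0) →
        ∫ u, conj (φ u) * fourierHat f u ∂S = ∫ t, f t * g t := by
  obtain ⟨χ, hχ, U, hU, hAU, hχU⟩ := exists_cutoff hA
  obtain ⟨g₀, hg₀, hrep⟩ := hS.exists_integral_conj_mul_fourierHat_eq hχ.2.1 hφ
  have hχ0 (t) (ht : t ∉ tsupport χ) : χ t = 0 := image_eq_zero_of_notMem_tsupport ht
  have hg : MemLp (fun t => χ t * g₀ t) 2 volume := by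
    obtain ⟨C, hC⟩ := (IsBddCompact.of_mem_testFunctions hχ).2.1
    exact hg₀.mul (memLp_top_of_bound hχ.1.continuous.aestronglyMeasurable C (.of_forall hC))
  have htest (h) (hh : h ∈ testFunctions Set.univ) :
      ∫ u, conj (φ u) * fourierHat h u ∂S = ∫ t, h t * (χ t * g₀ t) := by
    have hχh := mul_mem_testFunctions hχ hh
    rw [hS.integral_conj_mul_fourierHat_cutoff hφ horth hχ hU hAU hχU hh,
      hrep _ (IsBddCompact.of_mem_testFunctions hχh).memLp_two fun t ht => by simp [hχ0 t ht]]
    simp only [Pi.mul_apply, mul_left_comm, mul_assoc]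
  have hvanish : ∀ᵐ t, t ∉ A → χ t * g₀ t = 0 := by
    refine ae_eq_zero_compl_of_integral_testFunctions_mul hA.isClosed ?_ fun h hh => ?_
    · exact hg.locallyIntegrable one_le_two
    · rw [← htest h (mem_testFunctions_univ hh), horth h hh]
  have hind (f : EuclideanSpace ℝ (Fin d) → ℂ) :
      ∫ t, f t * A.indicator (fun t => χ t * g₀ t) t = ∫ t, f t * (χ t * g₀ t) := by
    refine integral_congr_ae (hvanish.mono fun t ht => ?_)
    by_cases htA : t ∈ A
    · simp [htA]
    · simp [htA, ht htA]
  refine ⟨A.indicator fun t => χ t * g₀ t, ?_, fun t ht => Set.indicator_of_notMem ht _,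
    fun h hh => (htest h hh).trans (hind h).symm, fun f hf hfA => ?_⟩
  · exact hg.indicator hA.measurableSet
  · rw [hind, hrep f hf fun t ht => hfA t fun htA => by simpa [hχU t (hAU htA)] using hχ0 t ht]
    refine integral_congr_ae (.of_forall fun t => ?_)
    by_cases htA : t ∈ A
    · simp [hχU t (hAU htA)]
    · simp [hfA t htA]

end Representation

section Orthogonality

variable {d : ℕ} {S : Measure (EuclideanSpace ℝ (Fin d))} {A : Set (EuclideanSpace ℝ (Fin d))}
  {φ ψ g g' : EuclideanSpace ℝ (Fin d) → ℂ}

theorem IsL2Fourier.ae_eq (hg : IsL2Fourier ψ g) (hg' : IsL2Fourier ψ g') : g =ᵐ[volume] g' := by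
  have hsub : MemLp (g - g') 2 volume := hg.1.sub hg'.1
  have hzero : ∀ᵐ t, t ∉ (∅ : Set (EuclideanSpace ℝ (Fin d))) → (g - g') t = 0 := by
    refine ae_eq_zero_compl_of_integral_testFunctions_mul isClosed_empty
      (hsub.locallyIntegrable one_le_two) fun h hh => ?_
    have hh2 := (IsBddCompact.of_mem_testFunctions hh).memLp_two
    have hint : Integrable fun t => h t * g t := hh2.integrable_mul hg.1
    have hint' : Integrable fun t => h t * g' t := hh2.integrable_mul hg'.1
    simp_rw [Pi.sub_apply, mul_sub]
    rw [integral_sub hint hint', hg.2 h (mem_testFunctions_univ hh),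
      hg'.2 h (mem_testFunctions_univ hh), sub_self]
  filter_upwards [hzero] with t ht using sub_eq_zero.1 (ht (Set.notMem_empty t))

theorem IsTranslationBounded.exists_fourierHatInv_of_isOrthogonalOutside
    (hS : IsTranslationBounded S) (hA : IsCompact A) (hφ : MemLp φ 2 S)
    (horth : IsOrthogonalOutside S A φ) :
    ∃ g, IsL2Fourier (fourierHatInv g) g ∧ fourierHatInv g ∈ expTypeClass A ∧
      (∀ᵐ u, (spectralDensity S u).toReal * conj (φ u) = fourierHatInv g u) ∧
      (∀ᵐ u ∂(S.singularPart volume), φ u = 0) ∧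
      ∀ f, MemLp f 2 volume → (∀ t ∉ A, f t = 0) →
        ∫ u, conj (φ u) * fourierHat f u ∂S = ∫ t, f t * g t := by
  have := hS.isLocallyFiniteMeasure
  obtain ⟨g, hg2, hgA, htest, hpair⟩ := hS.exists_memLp_of_isOrthogonalOutside hA hφ horth
  have hg : Integrable g := by
    rw [← Set.indicator_eq_self.2 (Function.support_subset_iff'.2 hgA)]
    exact integrable_indicator_of_memLp_two hA hg2
  obtain ⟨C, hC⟩ := exists_norm_fourierHatInv_le g
  obtain ⟨hac, hsing⟩ := ae_eq_of_integral_fourierHat_eq (S := S) (φ := fun u => conj (φ u))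
    (ψ := fourierHatInv g)
    (fun h hh => by
      simpa only [mul_comm] using
        hS.integrable_conj_mul_fourierHat hφ (IsBddCompact.of_mem_testFunctions hh))
    (fun h hh => (integrable_fourierHat hh).mul_bdd
      (continuous_fourierHatInv hg).aestronglyMeasurable (.of_forall hC))
    (fun h hh => by
      rw [integral_fourierHat_mul_fourierHatInv hh hg, ← htest h hh]
      simp only [mul_comm])
  exact ⟨g, isL2Fourier_fourierHatInv hg hg2, fourierHatInv_mem_expTypeClass hg hA hgA, hac,
    hsing.mono fun u hu => by simpa using hu, hpair⟩

theorem IsTranslationBounded.isOrthogonalOutside_of_mem_expTypeClass (hS : IsTranslationBounded S)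
    (hφ : MemLp φ 2 S) (hψ : ψ ∈ expTypeClass A)
    (hac : ∀ᵐ u, (spectralDensity S u).toReal * conj (φ u) = ψ u)
    (hsing : ∀ᵐ u ∂(S.singularPart volume), φ u = 0) : IsOrthogonalOutside S A φ := by
  have := hS.isLocallyFiniteMeasure
  intro h hh
  rw [integral_conj_mul_eq hac hsing
    (hS.integrable_conj_mul_fourierHat hφ (.of_mem_testFunctions hh)), hψ.2.2 h hh]

theorem IsTranslationBounded.isOrthogonalOutside_iff (hS : IsTranslationBounded S)
    (hA : IsCompact A) (hφ : MemLp φ 2 S) :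
    IsOrthogonalOutside S A φ ↔ ∃ ψ ∈ expTypeClass A, SqIntegrableInv (spectralDensity S) ψ ∧
      IsDivDensity S φ (fun u => conj (ψ u)) := by
  have := hS.isLocallyFiniteMeasure
  constructor
  · intro horth
    obtain ⟨g, -, hψ, hac, hsing, -⟩ :=
      hS.exists_fourierHatInv_of_isOrthogonalOutside hA hφ horth
    have hsq : SqIntegrableInv (spectralDensity S) (fourierHatInv g) := by
      rw [SqIntegrableInv, ← lintegral_enorm_sq_eq_mul_inv hac hsing]
      exact (memLp_two_iff_lintegral hφ.1).1 hφ
    exact ⟨_, hψ, hsq, (isDivDensity_conj_iff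
      (hsq.ae_eq_zero hψ.1.continuous.measurable.aemeasurable)).2 ⟨hac, hsing⟩⟩
  · rintro ⟨ψ, hψ, hsq, hdiv⟩
    obtain ⟨hac, hsing⟩ := (isDivDensity_conj_iff
      (hsq.ae_eq_zero hψ.1.continuous.measurable.aemeasurable)).1 hdiv
    exact hS.isOrthogonalOutside_of_mem_expTypeClass hφ hψ hac hsing

theorem IsTranslationBounded.exists_isOrthogonalOutside_of_mem_expTypeClass
    (hS : IsTranslationBounded S) (hA : IsCompact A) (hψ : ψ ∈ expTypeClass A)
    (hψ2 : SqIntegrableInv (spectralDensity S) ψ) :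
    ∃ φ g, MemLp φ 2 S ∧ IsOrthogonalOutside S A φ ∧ IsL2Fourier ψ g ∧
      ∀ f, MemLp f 2 volume → (∀ t ∉ A, f t = 0) →
        ∫ u, conj (φ u) * fourierHat f u ∂S = ∫ t, f t * g t := by
  have := hS.isLocallyFiniteMeasure
  obtain ⟨φ, hφ, hac, hsing⟩ :=
    exists_memLp_spectralDensity_mul_conj_ae_eq hψ.1.continuous.measurable.aemeasurable hψ2
  have horth := hS.isOrthogonalOutside_of_mem_expTypeClass hφ hψ hac hsing
  obtain ⟨g, hg2, -, htest, hpair⟩ := hS.exists_memLp_of_isOrthogonalOutside hA hφ horth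
  refine ⟨φ, g, hφ, horth, ⟨hg2, fun h hh => ?_⟩, hpair⟩
  rw [← htest h hh, integral_conj_mul_eq hac hsing
    (hS.integrable_conj_mul_fourierHat hφ (.of_mem_testFunctions hh))]

theorem IsTranslationBounded.exists_isL2Fourier (hS : IsTranslationBounded S) (hA : IsCompact A)
    (hψ : ψ ∈ expTypeClass A) (hψ2 : SqIntegrableInv (spectralDensity S) ψ) :
    ∃ g, IsL2Fourier ψ g := by
  obtain ⟨-, g, -, -, hg, -⟩ := hS.exists_isOrthogonalOutside_of_mem_expTypeClass hA hψ hψ2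
  exact ⟨g, hg⟩

theorem IsTranslationBounded.forall_integral_conj_mul_fourierHat_eq_zero_iff
    (hS : IsTranslationBounded S) (hA : IsCompact A) {f : EuclideanSpace ℝ (Fin d) → ℂ}
    (hf : MemLp f 2 volume) (hfA : ∀ t ∉ A, f t = 0) :
    (∀ φ, MemLp φ 2 S → IsOrthogonalOutside S A φ → ∫ u, conj (φ u) * fourierHat f u ∂S = 0) ↔
      ∀ ψ ∈ expTypeClass A, SqIntegrableInv (spectralDensity S) ψ →
        ∀ g, IsL2Fourier ψ g → ∫ t, f t * g t = 0 := by
  constructor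
  · intro h ψ hψ hψ2 g hg
    obtain ⟨φ, g', hφ, horth, hg', hpair⟩ :=
      hS.exists_isOrthogonalOutside_of_mem_expTypeClass hA hψ hψ2
    calc ∫ t, f t * g t = ∫ t, f t * g' t :=
          integral_congr_ae ((hg.ae_eq hg').mono fun t ht => by simp only [ht])
      _ = 0 := by rw [← hpair f hf hfA, h φ hφ horth]
  · intro h φ hφ horth
    obtain ⟨g, hg, hψ, hac, hsing, hpair⟩ :=
      hS.exists_fourierHatInv_of_isOrthogonalOutside hA hφ horth
    have := hS.isLocallyFiniteMeasure
    rw [hpair f hf hfA]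
    refine h _ hψ ?_ g hg
    rw [SqIntegrableInv, ← lintegral_enorm_sq_eq_mul_inv hac hsing]
    exact (memLp_two_iff_lintegral hφ.1).1 hφ

end Orthogonality

section ClosedGraph

variable {d : ℕ} {S : Measure (EuclideanSpace ℝ (Fin d))}

theorem continuous_fourierHatLp {V : Type*} [NormedAddCommGroup V] [NormedSpace ℂ V]
    [CompleteSpace V] {f : V → EuclideanSpace ℝ (Fin d) → ℂ} {hint : ∀ v, Integrable (f v)}
    {hmem : ∀ v, MemLp (fourierHat (f v)) 2 S} {hadd : ∀ v w, f (v + w) =ᵐ[volume] f v + f w}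
    {hsmul : ∀ (c : ℂ) v, f (c • v) =ᵐ[volume] c • f v}
    (hcont : ∀ u, Continuous fun v => fourierHat (f v) u) :
    Continuous (fourierHatLp S f hint hmem hadd hsmul) := by
  refine LinearMap.continuous_of_seq_closed_graph _ fun v w y hv hy => Lp.ext ?_
  obtain ⟨ns, hns, hae⟩ := (tendstoInMeasure_of_tendsto_Lp hy).exists_seq_tendsto_ae
  have hvn (n) : fourierHatLp S f hint hmem hadd hsmul (v n) =ᵐ[S] fourierHat (f (v n)) :=
    coeFn_fourierHatLp (v n)
  filter_upwards [hae, ae_all_iff.2 hvn, coeFn_fourierHatLp w] with u hlim hvn hw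
  simp only [Function.comp_apply, hvn] at hlim
  rw [hw]
  exact tendsto_nhds_unique hlim (((hcont u).tendsto w).comp (hv.comp hns.tendsto_atTop))

theorem continuous_fourierHat_bcf_mul {e : EuclideanSpace ℝ (Fin d) → ℂ} (he : IsBddCompact e)
    (u : EuclideanSpace ℝ (Fin d)) :
    Continuous fun b : BoundedContinuousFunction (EuclideanSpace ℝ (Fin d)) ℂ =>
      fourierHat (fun t => b t * e t) u := by
  refine (LipschitzWith.of_dist_le' (K := ∫ t, ‖e t‖) fun b b' => ?_).continuous
  have hbe := (he.bcf_mul b).integrable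
  have hbe' := (he.bcf_mul b').integrable
  calc dist (fourierHat (fun t => b t * e t) u) (fourierHat (fun t => b' t * e t) u)
      = ‖fourierHat ((fun t => b t * e t) - fun t => b' t * e t) u‖ := by
        rw [fourierHat_sub hbe hbe', Pi.sub_apply, dist_eq_norm]
    _ ≤ ∫ t, ‖((fun t => b t * e t) - fun t => b' t * e t) t‖ := norm_fourierHat_le _ _
    _ ≤ ∫ t, dist b b' * ‖e t‖ := by
        refine integral_mono (hbe.sub hbe').norm (he.integrable.norm.const_mul _) fun t => ?_
        simp only [Pi.sub_apply, ← sub_mul, norm_mul, ← dist_eq_norm]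
        gcongr
        exact BoundedContinuousFunction.dist_coe_le_dist t
    _ = (∫ t, ‖e t‖) * dist b b' := by rw [integral_const_mul, mul_comm]

theorem exists_lintegral_fourierHat_sub_le {e : EuclideanSpace ℝ (Fin d) → ℂ} (he : IsBddCompact e)
    (hS : ∀ b : BoundedContinuousFunction (EuclideanSpace ℝ (Fin d)) ℂ,
      MemLp (fourierHat fun t => b t * e t) 2 S) :
    ∃ C : ℝ≥0, ∀ u, ∫⁻ v, ‖fourierHat e (v - u)‖ₑ ^ 2 ∂S ≤ C := by
  let T : BoundedContinuousFunction (EuclideanSpace ℝ (Fin d)) ℂ →L[ℂ] Lp ℂ 2 S :=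
    ⟨fourierHatLp S (fun b t => b t * e t) (fun b => (he.bcf_mul b).integrable) hS
      (fun b b' => .of_eq (funext fun t => add_mul (b t) (b' t) (e t)))
      (fun c b => .of_eq (funext fun t => mul_assoc c (b t) (e t))),
      continuous_fourierHatLp (continuous_fourierHat_bcf_mul he)⟩
  have hT (b) : T b =ᵐ[S] fourierHat fun t => b t * e t := (hS b).coeFn_toLp
  refine ⟨‖T‖₊ ^ 2, fun u => ?_⟩
  let χ : BoundedContinuousFunction (EuclideanSpace ℝ (Fin d)) ℂ :=
    .ofNormedAddCommGroup (fun t => Complex.exp (Complex.I * ((inner ℝ u t : ℝ) : ℂ)))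
      (by fun_prop) 1 fun t => by rw [Complex.norm_exp]; simp
  have hχ : ‖χ‖ ≤ 1 := BoundedContinuousFunction.norm_ofNormedAddCommGroup_le _ zero_le_one _
  have hTχ : ‖T χ‖₊ ≤ ‖T‖₊ := T.le_of_opNorm_le_of_le le_rfl hχ |>.trans_eq (mul_one _)
  calc ∫⁻ v, ‖fourierHat e (v - u)‖ₑ ^ 2 ∂S = ∫⁻ v, ‖T χ v‖ₑ ^ 2 ∂S := by
        refine lintegral_congr_ae ((hT χ).mono fun v hv => ?_)
        simp only [hv, ← fourierHat_exp_mul]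
        rfl
    _ = ‖T χ‖ₑ ^ 2 := (enorm_Lp_two_sq _).symm
    _ ≤ ↑(‖T‖₊ ^ 2) := by rw [enorm_eq_nnnorm]; exact_mod_cast pow_le_pow_left' hTχ 2

theorem isTranslationBounded_of_memLp_fourierHat
    (hS : ∀ f : EuclideanSpace ℝ (Fin d) → ℂ, IsBddCompact f → MemLp (fourierHat f) 2 S) :
    IsTranslationBounded S := by
  let b : ContDiffBump (0 : EuclideanSpace ℝ (Fin d)) := ⟨1 / 4, 1 / 2, by norm_num, by norm_num⟩
  have hb : IsBddCompact fun t => (b t : ℂ) :=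
    .of_mem_testFunctions (ofReal_contDiffBump_mem_testFunctions b)
  obtain ⟨C, hC⟩ := exists_lintegral_fourierHat_sub_le hb fun β => hS _ (hb.bcf_mul β)
  let c : ℝ≥0 := ⟨1 / 2 * ∫ t, b t, by have := b.integral_pos (μ := volume); positivity⟩
  have hc : c ≠ 0 := fun h =>
    (mul_pos one_half_pos (b.integral_pos (μ := volume))).ne' (congrArg NNReal.toReal h)
  have hlower (u) (v) (hv : v ∈ closedBall u 1) :
      (c : ℝ≥0∞) ≤ ‖fourierHat (fun t => (b t : ℂ)) (v - u)‖ₑ := by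
    refine enorm_eq_nnnorm (E := ℂ) _ ▸ ENNReal.coe_le_coe.2 (NNReal.coe_le_coe.1 ?_)
    refine le_trans ?_ (mul_integral_contDiffBump_le b (v - u))
    have hvu : ‖v - u‖ ≤ 1 := mem_closedBall_iff_norm.1 hv
    have hr : 1 / 2 ≤ 1 - b.rOut * ‖v - u‖ := by
      change 1 / 2 ≤ 1 - 1 / 2 * ‖v - u‖
      linarith
    exact mul_le_mul_of_nonneg_right hr b.integral_pos.le
  refine ⟨C / c ^ 2, fun u => ?_⟩
  rw [ENNReal.coe_div (pow_ne_zero 2 hc), ENNReal.le_div_iff_mul_le (by simp [hc]) (by simp)]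
  calc S (closedBall u 1) * ↑(c ^ 2) = ∫⁻ v in closedBall u 1, (c : ℝ≥0∞) ^ 2 ∂S := by
        rw [setLIntegral_const, mul_comm, ENNReal.coe_pow]
    _ ≤ ∫⁻ v in closedBall u 1, ‖fourierHat (fun t => (b t : ℂ)) (v - u)‖ₑ ^ 2 ∂S :=
        setLIntegral_mono' isClosed_closedBall.measurableSet fun v hv => by
          gcongr
          exact hlower u v hv
    _ ≤ ∫⁻ v, ‖fourierHat (fun t => (b t : ℂ)) (v - u)‖ₑ ^ 2 ∂S := setLIntegral_le_lintegral _ _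
    _ ≤ C := hC u

end ClosedGraph

section Variance

variable {Ω : Type*} [MeasurableSpace Ω] {P : Measure Ω} {d : ℕ} {M : StatRandomMeasure P d}
  {S : Measure (EuclideanSpace ℝ (Fin d))} {f g : EuclideanSpace ℝ (Fin d) → ℂ}

theorem StatRandomMeasure.integral_sub (M : StatRandomMeasure P d)
    {f g : EuclideanSpace ℝ (Fin d) → ℝ} (hf : IsBddCompact f) (hg : IsBddCompact g) :
    M.integral (fun x => f x - g x) =ᵐ[P] fun ω => M.integral f ω - M.integral g ω := by
  filter_upwards [M.linear (-1) g f hg hf] with ω h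
  simpa only [neg_one_mul, neg_add_eq_sub] using h

theorem StatRandomMeasure.cintegral_sub (M : StatRandomMeasure P d) (hf : IsBddCompact f)
    (hg : IsBddCompact g) :
    M.cintegral (f - g) =ᵐ[P] fun ω => M.cintegral f ω - M.cintegral g ω := by
  filter_upwards [M.integral_sub hf.re hg.re, M.integral_sub hf.im hg.im] with ω hre him
  simp only [StatRandomMeasure.cintegral, Pi.sub_apply, Complex.sub_re, Complex.sub_im, hre, him]
  push_cast
  ring

theorem complexVariance_congr {X Y : Ω → ℂ} (h : X =ᵐ[P] Y) :
    complexVariance P X = complexVariance P Y := by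
  rw [complexVariance, complexVariance, integral_congr_ae h]
  exact integral_congr_ae (h.mono fun ω hω => by simp only [hω])

theorem complexVariance_nonneg (X : Ω → ℂ) : 0 ≤ complexVariance P X :=
  integral_nonneg fun _ => by positivity

theorem complexVariance_add_I_mul [IsFiniteMeasure P] {X Y : Ω → ℝ} (hX : MemLp X 2 P)
    (hY : MemLp Y 2 P) :
    complexVariance P (fun ω => (X ω : ℂ) + Complex.I * Y ω) = Var[X; P] + Var[Y; P] := by
  have hXi : Integrable X P := hX.integrable one_le_two
  have hYi : Integrable Y P := hY.integrable one_le_two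
  have hmean : ∫ ω, ((X ω : ℂ) + Complex.I * Y ω) ∂P =
      (∫ ω, X ω ∂P : ℝ) + Complex.I * (∫ ω, Y ω ∂P : ℝ) := by
    rw [integral_add hXi.ofReal (hYi.ofReal.const_mul _), integral_const_mul,
      integral_complex_ofReal, integral_complex_ofReal]
  have hXsq : Integrable (fun ω => (X ω - P[X]) ^ 2) P := (hX.sub (memLp_const _)).integrable_sq
  have hYsq : Integrable (fun ω => (Y ω - P[Y]) ^ 2) P := (hY.sub (memLp_const _)).integrable_sq
  rw [variance_eq_integral hX.1.aemeasurable, variance_eq_integral hY.1.aemeasurable,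
    complexVariance, hmean, ← integral_add hXsq hYsq]
  refine integral_congr_ae (.of_forall fun ω => ?_)
  simp [← Complex.normSq_eq_norm_sq, Complex.normSq_apply, ← sq]

theorem enorm_add_sq_add_enorm_sub_sq (a b : ℂ) :
    ‖a + b‖ₑ ^ 2 + ‖a - b‖ₑ ^ 2 = 2 * (‖a‖ₑ ^ 2 + ‖b‖ₑ ^ 2) := by
  simp only [enorm_eq_nnnorm]
  exact_mod_cast parallelogram_law_with_nnnorm ℝ a b

theorem fourierHat_eq_re_add_im (hf : IsBddCompact f) (u : EuclideanSpace ℝ (Fin d)) :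
    fourierHat f u = fourierHat (fun t => ((f t).re : ℂ)) u +
      Complex.I * fourierHat (fun t => ((f t).im : ℂ)) u := by
  have hre : Integrable fun t => ((f t).re : ℂ) := hf.re.integrable.ofReal
  have him : Integrable fun t => ((f t).im : ℂ) := hf.im.integrable.ofReal
  have hdecomp : f = (fun t => ((f t).re : ℂ)) + Complex.I • fun t => ((f t).im : ℂ) :=
    funext fun t => by simp [mul_comm Complex.I, Complex.re_add_im]
  conv_lhs => rw [hdecomp, fourierHat_add hre (him.smul _), fourierHat_smul]
  rfl

theorem enorm_fourierHat_sq_add_neg (hf : IsBddCompact f) (u : EuclideanSpace ℝ (Fin d)) :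
    ‖fourierHat f u‖ₑ ^ 2 + ‖fourierHat f (-u)‖ₑ ^ 2 =
      2 * (‖fourierHat (fun t => ((f t).re : ℂ)) u‖ₑ ^ 2 +
        ‖fourierHat (fun t => ((f t).im : ℂ)) u‖ₑ ^ 2) := by
  have hneg : conj (fourierHat f (-u)) = fourierHat (fun t => ((f t).re : ℂ)) u -
      Complex.I * fourierHat (fun t => ((f t).im : ℂ)) u := by
    have hreal (g : EuclideanSpace ℝ (Fin d) → ℝ) :
        conj (fourierHat (fun t => (g t : ℂ)) (-u)) = fourierHat (fun t => (g t : ℂ)) u := by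
      simpa using (fourierHat_conj (fun t => (g t : ℂ)) u).symm
    rw [fourierHat_eq_re_add_im hf, map_add, map_mul, hreal, hreal, Complex.conj_I, neg_mul,
      sub_eq_add_neg]
  have hI : ‖Complex.I‖ₑ = 1 := by simp [enorm_eq_nnnorm]
  rw [← RCLike.enorm_conj (fourierHat f (-u)), hneg, fourierHat_eq_re_add_im hf,
    enorm_add_sq_add_enorm_sub_sq, enorm_mul Complex.I, hI, one_mul]

theorem IsSpectralMeasure.lintegral_neg (hS : IsSpectralMeasure M S)
    (F : EuclideanSpace ℝ (Fin d) → ℝ≥0∞) : ∫⁻ u, F (-u) ∂S = ∫⁻ u, F u ∂S := by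
  conv_rhs => rw [← hS.even]
  exact (lintegral_map_equiv F (MeasurableEquiv.neg _)).symm

theorem IsSpectralMeasure.lintegral_enorm_fourierHat_sq_eq (hS : IsSpectralMeasure M S)
    (hf : IsBddCompact f) : ∫⁻ u, ‖fourierHat f u‖ₑ ^ 2 ∂S =
      ENNReal.ofReal (Var[M.integral fun x => (f x).re; P]) +
        ENNReal.ofReal (Var[M.integral fun x => (f x).im; P]) := by
  have hre : Integrable fun t => ((f t).re : ℂ) := hf.re.integrable.ofReal
  refine (ENNReal.mul_right_inj two_ne_zero ENNReal.ofNat_ne_top).1 ?_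
  calc 2 * ∫⁻ u, ‖fourierHat f u‖ₑ ^ 2 ∂S
      = ∫⁻ u, (‖fourierHat f u‖ₑ ^ 2 + ‖fourierHat f (-u)‖ₑ ^ 2) ∂S := by
        rw [lintegral_add_left (measurable_enorm_fourierHat_sq hf.integrable),
          hS.lintegral_neg fun u => ‖fourierHat f u‖ₑ ^ 2, two_mul]
    _ = 2 * (∫⁻ u, ‖fourierHat (fun t => ((f t).re : ℂ)) u‖ₑ ^ 2 ∂S +
          ∫⁻ u, ‖fourierHat (fun t => ((f t).im : ℂ)) u‖ₑ ^ 2 ∂S) := by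
        simp_rw [enorm_fourierHat_sq_add_neg hf]
        rw [lintegral_const_mul' _ _ ENNReal.ofNat_ne_top,
          lintegral_add_left (measurable_enorm_fourierHat_sq hre)]
    _ = _ := by rw [hS.variance_eq _ hf.re, hS.variance_eq _ hf.im]

theorem IsSpectralMeasure.isTranslationBounded (hS : IsSpectralMeasure M S) :
    IsTranslationBounded S := by
  refine isTranslationBounded_of_memLp_fourierHat fun f hf => (memLp_two_iff_lintegral
    (continuous_fourierHat hf.integrable).aestronglyMeasurable).2 ?_
  rw [hS.lintegral_enorm_fourierHat_sq_eq hf]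
  exact ENNReal.add_lt_top.2 ⟨ENNReal.ofReal_lt_top, ENNReal.ofReal_lt_top⟩

variable [IsFiniteMeasure P]

theorem IsSpectralMeasure.ofReal_complexVariance_cintegral (hS : IsSpectralMeasure M S)
    (hf : IsBddCompact f) :
    ENNReal.ofReal (complexVariance P (M.cintegral f)) = ∫⁻ u, ‖fourierHat f u‖ₑ ^ 2 ∂S := by
  rw [hS.lintegral_enorm_fourierHat_sq_eq hf,
    ← ENNReal.ofReal_add (variance_nonneg _ _) (variance_nonneg _ _)]
  exact congrArg _ (complexVariance_add_I_mul (M.memLp _ hf.re) (M.memLp _ hf.im))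

theorem IsSpectralMeasure.complexVariance_cintegral_conj (hS : IsSpectralMeasure M S)
    (hf : IsBddCompact f) :
    complexVariance P (M.cintegral fun t => conj (f t)) = complexVariance P (M.cintegral f) := by
  rw [← ENNReal.ofReal_eq_ofReal_iff (complexVariance_nonneg _) (complexVariance_nonneg _),
    hS.ofReal_complexVariance_cintegral hf.conj, hS.ofReal_complexVariance_cintegral hf,
    ← hS.lintegral_neg fun u => ‖fourierHat f u‖ₑ ^ 2]
  simp only [fourierHat_conj, RCLike.enorm_conj]

end Variance

section Rigidity

theorem iInf_dist_sq_eq_zero_iff {ι X : Type*} [Nonempty ι] [PseudoMetricSpace X] (x : X)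
    (y : ι → X) : ⨅ i, dist x (y i) ^ 2 = 0 ↔ x ∈ closure (Set.range y) := by
  have hbdd : BddBelow (Set.range fun i => dist x (y i) ^ 2) :=
    ⟨0, Set.forall_mem_range.2 fun i => sq_nonneg _⟩
  rw [Metric.mem_closure_range_iff]
  constructor
  · intro h ε hε
    obtain ⟨i, hi⟩ := exists_lt_of_ciInf_lt (h.trans_lt (pow_pos hε 2))
    exact ⟨i, lt_of_pow_lt_pow_left₀ 2 hε.le hi⟩
  · refine fun h => le_antisymm (le_of_forall_pos_lt_add fun ε hε => ?_)
      (le_ciInf fun i => sq_nonneg _)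
    obtain ⟨i, hi⟩ := h √ε (Real.sqrt_pos.2 hε)
    refine (ciInf_le hbdd i).trans_lt ?_
    rw [zero_add, ← Real.sq_sqrt hε.le]
    exact pow_lt_pow_left₀ hi dist_nonneg two_ne_zero

variable {Ω : Type*} [MeasurableSpace Ω] {P : Measure Ω} {d : ℕ} {M : StatRandomMeasure P d}
  {S : Measure (EuclideanSpace ℝ (Fin d))} {f h γ : EuclideanSpace ℝ (Fin d) → ℂ}
  {A U : Set (EuclideanSpace ℝ (Fin d))}

theorem conj_mem_testFunctions (hh : h ∈ testFunctions U) :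
    (fun t => conj (h t)) ∈ testFunctions U :=
  ⟨Complex.conjCLE.contDiff.comp hh.1, hh.2.1.comp_left (map_zero _),
    (tsupport_comp_subset (map_zero _) h).trans hh.2.2⟩

/-- The test functions supported in `U`, as a linear subspace. -/
def testFunctionSubmodule (U : Set (EuclideanSpace ℝ (Fin d))) :
    Submodule ℂ (EuclideanSpace ℝ (Fin d) → ℂ) where
  carrier := testFunctions U
  add_mem' hf hg := ⟨hf.1.add hg.1, hf.2.1.add hg.2.1, (closure_mono
    (Function.support_add _ _)).trans (closure_union.trans_subset (Set.union_subset hf.2.2 hg.2.2))⟩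
  zero_mem' := ⟨contDiff_const, .zero, by simp [tsupport]⟩
  smul_mem' c _ hf := ⟨contDiff_const.smul hf.1, hf.2.1.smul_left,
    (tsupport_smul_subset_right (fun _ => c) _).trans hf.2.2⟩

/-- The Fourier transform of test functions supported in `U`, as a linear map into `L²(S)`. -/
def IsTranslationBounded.testFourierLp (hS : IsTranslationBounded S)
    (U : Set (EuclideanSpace ℝ (Fin d))) : testFunctionSubmodule U →ₗ[ℂ] Lp ℂ 2 S :=
  fourierHatLp S Subtype.val (fun h => (IsBddCompact.of_mem_testFunctions h.2).integrable)
    (fun h => hS.memLp_fourierHat_of_isBddCompact (.of_mem_testFunctions h.2))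
    (fun _ _ => .rfl) (fun _ _ => .rfl)

theorem IsTranslationBounded.testFourierLp_ae_eq (hS : IsTranslationBounded S)
    (h : testFunctionSubmodule U) : hS.testFourierLp U h =ᵐ[S] fourierHat h.1 :=
  (hS.memLp_fourierHat_of_isBddCompact (.of_mem_testFunctions h.2)).coeFn_toLp

theorem IsTranslationBounded.mem_closure_range_testFourierLp_iff (hS : IsTranslationBounded S)
    {F : EuclideanSpace ℝ (Fin d) → ℂ} (hF : MemLp F 2 S) :
    hF.toLp F ∈ closure (Set.range (hS.testFourierLp Aᶜ)) ↔
      ∀ φ, MemLp φ 2 S → IsOrthogonalOutside S A φ → ∫ u, conj (φ u) * F u ∂S = 0 := by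
  have horth {φ : EuclideanSpace ℝ (Fin d) → ℂ} (x : Lp ℂ 2 S) (hx : x =ᵐ[S] φ) :
      x ∈ (hS.testFourierLp Aᶜ).rangeᗮ ↔ IsOrthogonalOutside S A φ := by
    have hinner (h : testFunctionSubmodule Aᶜ) :=
      inner_eq_integral_conj_mul hx (hS.testFourierLp_ae_eq h)
    refine (Submodule.mem_orthogonal' _ _).trans ⟨fun hx h hh => ?_, ?_⟩
    · exact (hinner ⟨h, hh⟩).symm.trans (hx _ ⟨⟨h, hh⟩, rfl⟩)
    · rintro hφ _ ⟨h, rfl⟩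
      exact (hinner h).trans (hφ h.1 h.2)
  rw [← LinearMap.coe_range, ← Submodule.topologicalClosure_coe, SetLike.mem_coe,
    ← Submodule.orthogonal_orthogonal_eq_closure, Submodule.mem_orthogonal]
  refine ⟨fun hmem φ hφ hφA => ?_, fun hint x hx => ?_⟩
  · rw [← inner_eq_integral_conj_mul hφ.coeFn_toLp hF.coeFn_toLp]
    exact hmem _ ((horth _ hφ.coeFn_toLp).2 hφA)
  · rw [inner_eq_integral_conj_mul .rfl hF.coeFn_toLp]
    exact hint x (Lp.memLp x) ((horth x .rfl).1 hx)

theorem linearlyRigid_iff_iInf_sub (hA : MeasurableSet A) (hγ : IsBddCompact γ) :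
    LinearlyRigid M γ A ↔
      ⨅ h : testFunctions Aᶜ, complexVariance P (M.cintegral (A.indicator γ - h.1)) = 0 := by
  rw [LinearlyRigid, iInf_congr fun h : testFunctions Aᶜ => complexVariance_congr
    (M.cintegral_sub (hγ.indicator hA) (.of_mem_testFunctions h.2)).symm]

variable [IsFiniteMeasure P]

theorem IsSpectralMeasure.linearlyRigid_conj_iff (hS : IsSpectralMeasure M S)
    (hA : MeasurableSet A) (hγ : IsBddCompact γ) :
    LinearlyRigid M (fun t => conj (γ t)) A ↔ LinearlyRigid M γ A := by
  let conjTest (h : testFunctions Aᶜ) : testFunctions Aᶜ := ⟨_, conj_mem_testFunctions h.2⟩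
  have hconj : Function.Involutive conjTest := fun h =>
    Subtype.ext (funext fun t => Complex.conj_conj (h.1 t))
  rw [linearlyRigid_iff_iInf_sub hA hγ.conj, linearlyRigid_iff_iInf_sub hA hγ,
    hconj.surjective.iInf_congr conjTest fun h => ?_]
  rw [← hS.complexVariance_cintegral_conj
    ((hγ.conj.indicator hA).sub (.of_mem_testFunctions h.2))]
  congr 2 with t
  by_cases ht : t ∈ A <;> simp [conjTest, ht]

theorem IsSpectralMeasure.complexVariance_cintegral_sub (hS : IsSpectralMeasure M S)
    (hf : IsBddCompact f) (hh : IsBddCompact h) {F H : Lp ℂ 2 S}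
    (hF : F =ᵐ[S] fourierHat f) (hH : H =ᵐ[S] fourierHat h) :
    complexVariance P (M.cintegral (f - h)) = dist F H ^ 2 := by
  rw [← ENNReal.ofReal_eq_ofReal_iff (complexVariance_nonneg _) (sq_nonneg _),
    hS.ofReal_complexVariance_cintegral (hf.sub hh), ENNReal.ofReal_pow dist_nonneg, dist_eq_norm,
    ofReal_norm, enorm_Lp_two_sq, fourierHat_sub hf.integrable hh.integrable]
  refine lintegral_congr_ae ?_
  filter_upwards [Lp.coeFn_sub F H, hF, hH] with u hsub hFu hHu
  rw [hsub, Pi.sub_apply, Pi.sub_apply, hFu, hHu]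

theorem IsSpectralMeasure.linearlyRigid_iff_mem_closure (hS : IsSpectralMeasure M S)
    (hA : MeasurableSet A) (hγ : IsBddCompact γ) (hF : MemLp (fourierHat (A.indicator γ)) 2 S) :
    LinearlyRigid M γ A ↔
      hF.toLp _ ∈ closure (Set.range (hS.isTranslationBounded.testFourierLp Aᶜ)) := by
  rw [linearlyRigid_iff_iInf_sub hA hγ, ← iInf_dist_sq_eq_zero_iff]
  exact iff_of_eq (congrArg (· = 0) (iInf_congr fun h : testFunctionSubmodule Aᶜ =>
    hS.complexVariance_cintegral_sub (hγ.indicator hA) (.of_mem_testFunctions h.2) hF.coeFn_toLp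
      (hS.isTranslationBounded.testFourierLp_ae_eq h)))

theorem IsSpectralMeasure.linearlyRigid_iff (hS : IsSpectralMeasure M S) (hA : IsCompact A)
    (hγ : IsBddCompact γ) :
    LinearlyRigid M γ A ↔ ∀ ψ ∈ expTypeClass A, SqIntegrableInv (spectralDensity S) ψ →
      ∀ g, IsL2Fourier ψ g → ∫ t in A, conj (γ t) * g t = 0 := by
  have hγA : IsBddCompact (A.indicator fun t => conj (γ t)) := hγ.conj.indicator hA.measurableSet
  have hset (g : EuclideanSpace ℝ (Fin d) → ℂ) : ∫ t in A, conj (γ t) * g t =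
      ∫ t, A.indicator (fun t => conj (γ t)) t * g t := by
    rw [← integral_indicator hA.measurableSet]
    simp only [Set.indicator_mul_left]
  have htb := hS.isTranslationBounded
  rw [← hS.linearlyRigid_conj_iff hA.measurableSet hγ,
    hS.linearlyRigid_iff_mem_closure hA.measurableSet hγ.conj
      (htb.memLp_fourierHat_of_isBddCompact hγA),
    htb.mem_closure_range_testFourierLp_iff,
    htb.forall_integral_conj_mul_fourierHat_eq_zero_iff hA hγA.memLp_two
      fun t ht => Set.indicator_of_notMem ht _]
  simp only [hset]

end Rigidity

end

theorem theorem5p3_general {Ω : Type*} [MeasurableSpace Ω] (P : Measure Ω) [IsFiniteMeasure P]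
    (d : ℕ) (M : StatRandomMeasure P d) (S : Measure (EuclideanSpace ℝ (Fin d)))
    (hS : IsSpectralMeasure M S) (A : Set (EuclideanSpace ℝ (Fin d))) (hA : IsCompact A) :
    (∀ ψ ∈ expTypeClass A, SqIntegrableInv (spectralDensity S) ψ → ∃ g, IsL2Fourier ψ g) ∧
    (∀ γ : EuclideanSpace ℝ (Fin d) → ℂ, IsBddCompact γ →
      (LinearlyRigid M γ A ↔
        ∀ ψ ∈ expTypeClass A, SqIntegrableInv (spectralDensity S) ψ →
          ∀ g, IsL2Fourier ψ g → ∫ t in A, conj (γ t) * g t = 0)) ∧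
    (∀ φ : EuclideanSpace ℝ (Fin d) → ℂ, MemLp φ 2 S →
      (IsOrthogonalOutside S A φ ↔
        ∃ ψ ∈ expTypeClass A, SqIntegrableInv (spectralDensity S) ψ ∧
          IsDivDensity S φ (fun u => conj (ψ u)))) :=
  ⟨fun _ hψ hψ2 => hS.isTranslationBounded.exists_isL2Fourier hA hψ hψ2,
    fun _ hγ => hS.linearlyRigid_iff hA hγ,
    fun _ hφ => hS.isTranslationBounded.isOrthogonalOutside_iff hA hφ⟩

theorem theorem5p3 {Ω : Type*} [MeasurableSpace Ω] (P : Measure Ω) [IsProbabilityMeasure P]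
    (d : ℕ) (M : StatRandomMeasure P d) (S : Measure (EuclideanSpace ℝ (Fin d)))
    (hS : IsSpectralMeasure M S)
    (A : Set (EuclideanSpace ℝ (Fin d))) (hAcompact : IsCompact A) (hAconvex : Convex ℝ A)
    (hAint : (interior A).Nonempty) :
    (∀ ψ ∈ expTypeClass A, SqIntegrableInv (spectralDensity S) ψ → ∃ g, IsL2Fourier ψ g) ∧
    (∀ γ : EuclideanSpace ℝ (Fin d) → ℂ, IsBddCompact γ →
      (LinearlyRigid M γ A ↔
        ∀ ψ ∈ expTypeClass A, SqIntegrableInv (spectralDensity S) ψ →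
          ∀ g, IsL2Fourier ψ g → ∫ t in A, conj (γ t) * g t = 0)) ∧
    (∀ φ : EuclideanSpace ℝ (Fin d) → ℂ, MemLp φ 2 S →
      (IsOrthogonalOutside S A φ ↔
        ∃ ψ ∈ expTypeClass A, SqIntegrableInv (spectralDensity S) ψ ∧
          IsDivDensity S φ (fun u => conj (ψ u)))) :=
  theorem5p3_general P d M S hS A hAcompact
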